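/- **Conventions.** Fix a commutative ring $R$. A directed graph $G$ consists of a set $V(G)$ of vertices and a set $E(G)\subseteq V(G)\times V(G)$ of edges (loops are allowed); write $x\to y$ for $(x,y)\in E(G)$. A map $G\to H$ of directed graphs is a function $f\colon V(G)\to V(H)$ such that for each edge $x\to y$ of $G$ either $f(x)=f(y)$ or $f(x)\to f(y)$ is an edge of $H$. Let $d(x,y)\in\mathbb N\cup\{\infty\}$ be the minimal number of edges in a directed path from $x$ to $y$ ($\infty$ if there is none). The reachability chain complex $\mathrm{RC}_*(G)$ is the complex of $R$-modules that in degree $k\ge 0$ is free on the tuples $(x_0,\dots,x_k)$ of vertices with $x_{i-1}\neq x_i$ and $d(x_{i-1},x_i)<\infty$ for all $i$, with differential $\partial(x_0,\dots,x_k)=\sum_{i}(-1)^i(x_0,\dots,\widehat{x_i},\dots,x_k)$, where terms with repeated consecutive entries are omitted (and $\partial=0$ in degree $0$). It is functorial in $G$, a tuple whose image has repeated consecutive entries being sent to $0$. It is filtered by letting $F_p\mathrm{RC}_*(G)$ be spanned by the tuples with $d(x_0,x_1)+\dots+d(x_{k-1},x_k)\le p$. For a subgraph $A$ of $X$ put $\mathrm{RC}(X,A)=\mathrm{RC}(X)/\mathrm{RC}(A)$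 with $F_p\mathrm{RC}(X,A)$ the image of $F_p\mathrm{RC}(X)$. The relative magnitude-path spectral sequence $\{E^r_{p,q}(X,A),d^r\}_{r\ge 0}$ is the spectral sequence of this filtered complex $C=\mathrm{RC}(X,A)$: with $Z^r_{p}=\{x\in F_pC: \partial x\in F_{p-r}C\}$, $$E^r_{p,q}=\bigl(Z^r_p\big/(Z^{r-1}_{p-1}+\partial Z^{r-1}_{p+r-1})\bigr)_{\text{degree }p+q},\qquad d^r\colon E^r_{p,q}\to E^r_{p-r,q+r-1}\text{ induced by }\partial .$$ Relative magnitude homology and relative bigraded path homology are $\mathrm{MH}_{k,\ell}(X,A)=E^1_{\ell,k-\ell}(X,A)$ and $\mathrm{PH}_{k,\ell}(X,A)=E^2_{\ell,k-\ell}(X,A)$. A cofibration is an induced subgraph inclusion $A\hookrightarrow X$ such that (1) there are no edges of $X$ from vertices not in $A$ to vertices in $A$; and (2) for each vertex $x$ of $X$ that admits a directed path from some vertex of $A$ there is a vertex $\pi(x)\in A$ with $d(a,x)=d(a,\pi(x))+d(\pi(x),x)$ for every vertex $a$ of $A$. **Theorem (Excision in the magnitude-path spectral sequence).** Let $i\colon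 A\to X$ be a cofibration, let $f\colon A\to Y$ be an arbitrary map of directed graphs, and let $$\begin{array}{ccc}A&\xrightarrow{\ f\ }&Y\\ {\scriptstyle i}\downarrow&&\downarrow{\scriptstyle j}\\ X&\xrightarrow{\ g\ }&X\cup_AY\end{array}$$ be the pushout in the category of directed graphs. Then for every $r\ge 1$ the induced map $$E^r_{*,*}(X,A)\longrightarrow E^r_{*,*}(X\cup_AY,Y)$$ is an isomorphism, that is, it is bijective in every bidegree and commutes with the differentials $d^r$. In particular the induced maps $$\mathrm{MH}_{*,*}(X,A)\to\mathrm{MH}_{*,*}(X\cup_AY,Y)\quad\text{and}\quad \mathrm{PH}_{*,*}(X,A)\to\mathrm{PH}_{*,*}(X\cup_AY,Y)$$ are isomorphisms. -/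

import Mathlib

universe u v w

open CategoryTheory

/-! ### The category of directed graphs -/

/-- A directed graph: a set of vertices and a set of ordered pairs of vertices (the edges).
Loops are permitted, parallel edges are not. -/
structure DiGraph : Type (u + 1) where
  V : Type u
  graph : Digraph V

namespace DiGraph

/-- There is an edge `x → y`. -/
def Adj (G : DiGraph.{u}) (x y : G.V) : Prop := G.graph.Adj x y

/-- A map of directed graphs: every edge is sent to an edge or collapsed to a vertex. -/
@[ext]
structure Hom (G H : DiGraph.{u}) where
  toFun : G.V → H.V
  map_adj : ∀ x y, G.Adj x y → toFun x = toFun y ∨ H.Adj (toFun x) (toFun y)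

instance : Category.{u} DiGraph.{u} where
  Hom G H := Hom G H
  id _ := ⟨id, fun _ _ h => Or.inr h⟩
  comp f g := ⟨g.toFun ∘ f.toFun, fun x y h => by
    rcases f.map_adj x y h with h' | h'
    · exact Or.inl (congrArg g.toFun h')
    · exact g.map_adj _ _ h'⟩

/-- There is a directed path with exactly `n` edges from `x` to `y`. -/
def HasPath (G : DiGraph.{u}) : ℕ → G.V → G.V → Prop
  | 0, x, y => x = y
  | n + 1, x, y => ∃ z, G.Adj x z ∧ HasPath G n z y

/-- There is a directed path from `x` to `y`. -/
def Reachable (G : DiGraph.{u}) (x y : G.V) : Prop := ∃ n, G.HasPath n x y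

/-- The shortest path metric: the minimal number of edges in a directed path from `x` to `y`,
or `⊤` if there is no such path. -/
noncomputable def dist (G : DiGraph.{u}) (x y : G.V) : ℕ∞ :=
  ⨅ (n : ℕ) (_ : G.HasPath n x y), (n : ℕ∞)

/-- The length `d(x₀,x₁) + ⋯ + d(x_{k-1},x_k)` of a tuple of vertices. -/
noncomputable def length (G : DiGraph.{u}) : List G.V → ℕ∞
  | [] => 0
  | [_] => 0
  | x :: y :: l => G.dist x y + length G (y :: l)

variable {G H : DiGraph.{u}}

theorem HasPath.trans {m n : ℕ} {x y z : G.V} (h : G.HasPath m x y) (h' : G.HasPath n y z) :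
    G.HasPath (m + n) x z := by
  induction m generalizing x with
  | zero => cases h; simpa using h'
  | succ m ih =>
    obtain ⟨t, ht, h⟩ := h
    rw [Nat.add_right_comm]
    exact ⟨t, ht, ih h⟩

theorem HasPath.map (f : G ⟶ H) {n : ℕ} {x y : G.V} (h : G.HasPath n x y) :
    ∃ m ≤ n, H.HasPath m (f.toFun x) (f.toFun y) := by
  induction n generalizing x with
  | zero => cases h; exact ⟨0, le_rfl, rfl⟩
  | succ n ih =>
    obtain ⟨t, ht, h⟩ := h
    obtain ⟨m, hm, h⟩ := ih h
    rcases f.map_adj _ _ ht with e | e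
    · exact ⟨m, by omega, e ▸ h⟩
    · exact ⟨m + 1, by omega, _, e, h⟩

theorem Reachable.trans {x y z : G.V} (h : G.Reachable x y) (h' : G.Reachable y z) :
    G.Reachable x z := by
  obtain ⟨m, h⟩ := h
  obtain ⟨n, h'⟩ := h'
  exact ⟨_, h.trans h'⟩

theorem Reachable.map (f : G ⟶ H) {x y : G.V} (h : G.Reachable x y) :
    H.Reachable (f.toFun x) (f.toFun y) := by
  obtain ⟨n, h⟩ := h
  obtain ⟨m, -, h⟩ := h.map f
  exact ⟨m, h⟩

theorem dist_le {n : ℕ} {x y : G.V} (h : G.HasPath n x y) : G.dist x y ≤ n := iInf₂_le n h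

theorem dist_triangle (x y z : G.V) : G.dist x z ≤ G.dist x y + G.dist y z := by
  rw [dist, dist, dist]
  simp only [ENat.iInf_add, ENat.add_iInf]
  refine le_iInf₂ fun m hm => le_iInf₂ fun n hn => ?_
  exact_mod_cast dist_le (HasPath.trans (by assumption) (by assumption))

theorem dist_map_le (f : G ⟶ H) (x y : G.V) : H.dist (f.toFun x) (f.toFun y) ≤ G.dist x y := by
  refine le_iInf₂ fun n hn => ?_
  obtain ⟨m, hm, h⟩ := hn.map f
  exact (dist_le h).trans (by exact_mod_cast hm)

theorem length_le_cons (x : G.V) (l : List G.V) : G.length l ≤ G.length (x :: l) := by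
  cases l with
  | nil => exact le_rfl
  | cons y l => exact le_add_self

theorem length_eraseIdx_le (l : List G.V) (k : ℕ) : G.length (l.eraseIdx k) ≤ G.length l := by
  induction l generalizing k with
  | nil => simp
  | cons x l ih =>
    cases k with
    | zero => exact length_le_cons x l
    | succ k =>
      cases l with
      | nil => simp
      | cons y l =>
        cases k with
        | zero =>
          cases l with
          | nil => simp [length]
          | cons z l =>
            simp only [List.eraseIdx_cons_succ, List.eraseIdx_cons_zero, length, ← add_assoc]
            gcongr
            exact dist_triangle x y z
        | succ k =>
          have := ih (k + 1)
          simp only [List.eraseIdx_cons_succ, length] at this ⊢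
          gcongr

theorem length_map_le (f : G ⟶ H) (l : List G.V) : H.length (l.map f.toFun) ≤ G.length l := by
  induction l with
  | nil => exact le_rfl
  | cons x l ih =>
    cases l with
    | nil => exact le_rfl
    | cons y l =>
      simp only [List.map_cons, length] at ih ⊢
      gcongr
      exact dist_map_le f x y

/-- A cofibration: (the map underlying) an inclusion of an induced subgraph `A` of `X` such that
no edge of `X` enters `A` from outside, and such that each vertex `x` in the reach of `A`
projects to a vertex `π(x)` of `A`. -/
structure IsCofibration {A X : DiGraph.{u}} (i : A ⟶ X) : Prop where
  injective : Function.Injective i.toFun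
  induced : ∀ a b, X.Adj (i.toFun a) (i.toFun b) ↔ A.Adj a b
  no_entry : ∀ x a, x ∉ Set.range i.toFun → ¬ X.Adj x (i.toFun a)
  projects : ∀ x, (∃ a, X.Reachable (i.toFun a) x) →
    ∃ b : A.V, ∀ a : A.V, X.dist (i.toFun a) x =
      X.dist (i.toFun a) (i.toFun b) + X.dist (i.toFun b) x

end DiGraph

/-! ### Filtered chain complexes and their spectral sequences -/

/-- A chain complex of `R`-modules with an increasing filtration by subcomplexes
`⋯ ⊆ F p ⊆ F (p + 1) ⊆ ⋯`. -/
structure FilteredComplex (R : Type w) [CommRing R] where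
  C : ChainComplex (ModuleCat.{v} R) ℤ
  F : ℤ → ∀ n : ℤ, Submodule R (C.X n)
  mono : ∀ {p p' : ℤ}, p ≤ p' → ∀ n, F p n ≤ F p' n
  d_mem : ∀ (p m n : ℤ) (x : C.X m), x ∈ F p m → (C.d m n).hom x ∈ F p n

namespace FilteredComplex

variable {R : Type w} [CommRing R]

/-- A filtered chain map. -/
structure Hom (K L : FilteredComplex.{v} R) where
  φ : K.C ⟶ L.C
  map_mem : ∀ (p n : ℤ) (x : K.C.X n), x ∈ K.F p n → (φ.f n).hom x ∈ L.F p n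

variable (K L : FilteredComplex.{v} R)

/-- `Z^r_p` in total degree `n`: the elements `x ∈ F_p C_n` with `∂x ∈ F_{p-r} C_{n-1}`. -/
def Z (r p n : ℤ) : Submodule R (K.C.X n) :=
  K.F p n ⊓ (K.F (p - r) (n - 1)).comap (K.C.d n (n - 1)).hom

/-- `Z^{r-1}_{p-1} + ∂ Z^{r-1}_{p+r-1}` in total degree `n`. -/
def B (r p n : ℤ) : Submodule R (K.C.X n) :=
  K.Z (r - 1) (p - 1) n ⊔ (K.Z (r - 1) (p + r - 1) (n + 1)).map (K.C.d (n + 1) n).hom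

/-- The module `E^r_{p,q} = Z^r_p / (Z^{r-1}_{p-1} + ∂ Z^{r-1}_{p+r-1})` (in total degree `p + q`)
of the spectral sequence of a filtered complex. For `r = 0` this is `F_p C_{p+q} / F_{p-1} C_{p+q}`. -/
abbrev E (r : ℕ) (p q : ℤ) : Type v :=
  K.Z r p (p + q) ⧸ (K.B r p (p + q)).submoduleOf (K.Z r p (p + q))

variable {K L}

theorem d_mem_Z {r p n m : ℤ} (hm : m = n - 1) {x : K.C.X n} (hx : x ∈ K.Z r p n) :
    (K.C.d n m).hom x ∈ K.Z r (p - r) m := by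
  subst hm
  refine ⟨hx.2, ?_⟩
  have : (K.C.d (n - 1) (n - 1 - 1)).hom ((K.C.d n (n - 1)).hom x) = 0 := by
    rw [← LinearMap.comp_apply, ← ModuleCat.hom_comp, K.C.d_comp_d]; rfl
  change (K.C.d (n - 1) (n - 1 - 1)).hom ((K.C.d n (n - 1)).hom x) ∈ K.F _ _
  rw [this]
  exact zero_mem _

theorem d_mem_B {r p n m : ℤ} (hm : m = n - 1) {x : K.C.X n} (hx : x ∈ K.B r p n) :
    (K.C.d n m).hom x ∈ K.B r (p - r) m := by
  obtain rfl : n = m + 1 := by omega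
  obtain ⟨y, hy, z, hz, rfl⟩ := Submodule.mem_sup.1 hx
  obtain ⟨t, ht, rfl⟩ := hz
  have : (K.C.d (m + 1) m).hom ((K.C.d (m + 1 + 1) (m + 1)).hom t) = 0 := by
    rw [← LinearMap.comp_apply, ← ModuleCat.hom_comp, K.C.d_comp_d]; rfl
  rw [map_add, this, add_zero]
  refine Submodule.mem_sup_right ⟨y, ?_, rfl⟩
  rwa [show p - r + r - 1 = p - 1 by ring]

theorem Hom.comm_apply (h : K.Hom L) (m n : ℤ) (x : K.C.X m) :
    (L.C.d m n).hom ((h.φ.f m).hom x) = (h.φ.f n).hom ((K.C.d m n).hom x) := by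
  rw [← LinearMap.comp_apply, ← ModuleCat.hom_comp, h.φ.comm, ModuleCat.hom_comp,
    LinearMap.comp_apply]

theorem Hom.map_mem_Z (h : K.Hom L) {r p n : ℤ} {x : K.C.X n} (hx : x ∈ K.Z r p n) :
    (h.φ.f n).hom x ∈ L.Z r p n := by
  refine ⟨h.map_mem _ _ _ hx.1, ?_⟩
  change (L.C.d n (n - 1)).hom ((h.φ.f n).hom x) ∈ L.F _ _
  rw [h.comm_apply]
  exact h.map_mem _ _ _ hx.2

theorem Hom.map_mem_B (h : K.Hom L) {r p n : ℤ} {x : K.C.X n} (hx : x ∈ K.B r p n) :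
    (h.φ.f n).hom x ∈ L.B r p n := by
  obtain ⟨y, hy, z, ⟨t, ht, rfl⟩, rfl⟩ := Submodule.mem_sup.1 hx
  rw [map_add, ← h.comm_apply]
  exact add_mem (Submodule.mem_sup_left (h.map_mem_Z hy))
    (Submodule.mem_sup_right ⟨_, h.map_mem_Z ht, rfl⟩)

variable (K)

/-- The differential `d^r : E^r_{p,q} → E^r_{p-r,q+r-1}`, induced by the differential `∂`. -/
def dE (r : ℕ) (p q : ℤ) : K.E r p q →ₗ[R] K.E r (p - r) (q + r - 1) :=
  Submodule.mapQ _ _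
    ((K.C.d (p + q) (p - r + (q + r - 1))).hom.restrict
      fun _ hx => d_mem_Z (by ring) hx)
    fun _ hx => d_mem_B (by ring) hx

variable {K}

/-- The map of pages induced by a filtered chain map. -/
def Hom.mapE (h : K.Hom L) (r : ℕ) (p q : ℤ) : K.E r p q →ₗ[R] L.E r p q :=
  Submodule.mapQ _ _ ((h.φ.f (p + q)).hom.restrict fun _ hx => h.map_mem_Z hx)
    fun _ hx => h.map_mem_B hx

end FilteredComplex

/-! ### Reachability chains -/

namespace DiGraph

/-- The condition on a tuple `(x₀,…,x_n)` of vertices to be a generator of the reachability chains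
in degree `n`: consecutive entries are distinct and joined by a directed path. -/
def IsGen (G : DiGraph.{u}) (n : ℤ) (l : List G.V) : Prop :=
  l ≠ [] ∧ (l.length : ℤ) = n + 1 ∧ l.IsChain fun x y => x ≠ y ∧ G.Reachable x y

variable (R : Type w) [CommRing R]

/-- The free `R`-module on the generators in degree `n`. -/
abbrev RC (G : DiGraph.{u}) (n : ℤ) : Type (max u w) := {l : List G.V // G.IsGen n l} →₀ R

open Classical in
/-- The tuple `l` as an element of `RC_n(G)`, or `0` if `l` is not a generator in degree `n`. -/
noncomputable def gen (G : DiGraph.{u}) (n : ℤ) (l : List G.V) : RC R G n :=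
  if h : G.IsGen n l then Finsupp.single ⟨l, h⟩ 1 else 0

/-- The alternating sum `∑ (-1)^k (x₀,…,x̂_k,…,x_m)` as an element of `RC_n(G)`,
where terms that are not generators in degree `n` are omitted. -/
noncomputable def bdry (G : DiGraph.{u}) (n : ℤ) (l : List G.V) : RC R G n :=
  ∑ k ∈ Finset.range l.length, (-1 : R) ^ k • gen R G n (l.eraseIdx k)

/-- The differential of the reachability chains (zero unless `n = m - 1`). -/
noncomputable def RCd (G : DiGraph.{u}) (m n : ℤ) : RC R G m →ₗ[R] RC R G n :=
  Finsupp.linearCombination R fun l => bdry R G n l.1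

/-- The map of reachability chains induced by a map of graphs;
tuples whose image has repeated consecutive entries are sent to zero. -/
noncomputable def RCmap {G H : DiGraph.{u}} (f : G ⟶ H) (n : ℤ) : RC R G n →ₗ[R] RC R H n :=
  Finsupp.linearCombination R fun l => gen R H n (l.1.map f.toFun)

/-- The submodule of `RC_n(G)` spanned by the generators of length at most `p`. -/
noncomputable def RCF (G : DiGraph.{u}) (p n : ℤ) : Submodule R (RC R G n) :=
  Finsupp.supported R R {l | ∃ m : ℕ, (m : ℤ) ≤ p ∧ G.length l.1 ≤ m}

variable {R} {G H : DiGraph.{u}}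

section Aux

variable {M N : Type*} [AddCommGroup M] [Module R M] [AddCommGroup N] [Module R N] {α : Type*}

variable (R) in
/-- The alternating sum of the values of `g` on the faces of a list. -/
def altSum (g : List α → M) (l : List α) : M :=
  ∑ k ∈ Finset.range l.length, (-1 : R) ^ k • g (l.eraseIdx k)

theorem altSum_cons (g : List α → M) (x : α) (l : List α) :
    altSum R g (x :: l) = g l - altSum R (fun m => g (x :: m)) l := by
  simp only [altSum, List.length_cons, Finset.sum_range_succ', List.eraseIdx_cons_succ,
    List.eraseIdx_cons_zero, pow_zero, one_smul, pow_succ, mul_neg, mul_one, neg_smul,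
    Finset.sum_neg_distrib]
  abel

theorem altSum_sub (g h : List α → M) (l : List α) :
    altSum R (fun m => g m - h m) l = altSum R g l - altSum R h l := by
  simp [altSum, smul_sub]

theorem altSum_altSum (g : List α → M) (l : List α) : altSum R (altSum R g) l = 0 := by
  induction l generalizing g with
  | nil => simp [altSum]
  | cons x l ih =>
    rw [altSum_cons]
    simp only [altSum_cons, altSum_sub, ih]
    abel

theorem altSum_degenerate (g : List α → M) (hg : ∀ l, ¬ l.IsChain (· ≠ ·) → g l = 0)
    (l : List α) (hl : ¬ l.IsChain (· ≠ ·)) : altSum R g l = 0 := by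
  induction l generalizing g with
  | nil => simp at hl
  | cons x l ih =>
    cases l with
    | nil => simp at hl
    | cons y l =>
      by_cases hxy : x = y
      · subst hxy
        rw [altSum_cons, altSum_cons, sub_sub_cancel]
        refine Finset.sum_eq_zero fun k _ => ?_
        have : g (x :: x :: l.eraseIdx k) = 0 := hg _ (by simp)
        simp only [this, smul_zero]
      · have hl' : ¬ (y :: l).IsChain (· ≠ ·) := by simpa [hxy] using hl
        rw [altSum_cons, hg _ hl', ih _ _ hl', sub_zero]
        intro m hm
        refine hg _ fun h => hm ?_
        exact h.tail

end Aux

theorem isChain_eraseIdx {l : List G.V} (h : l.IsChain G.Reachable) (k : ℕ) :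
    (l.eraseIdx k).IsChain G.Reachable :=
  haveI : Trans G.Reachable G.Reachable G.Reachable := ⟨Reachable.trans⟩
  h.sublist (List.eraseIdx_sublist l k)

theorem IsGen.isChain {n : ℤ} {l : List G.V} (h : G.IsGen n l) : l.IsChain G.Reachable :=
  h.2.2.imp fun _ _ h => h.2

theorem isGen_iff {n : ℤ} {l : List G.V} (h : l.IsChain G.Reachable)
    (hn : (l.length : ℤ) = n + 1) : G.IsGen n l ↔ l ≠ [] ∧ l.IsChain (· ≠ ·) := by
  constructor
  · exact fun h' => ⟨h'.1, h'.2.2.imp fun _ _ h => h.1⟩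
  · refine fun h' => ⟨h'.1, hn, ?_⟩
    have h2 := h'.2
    clear h' hn
    induction l with
    | nil => simp
    | cons x l ih =>
      cases l with
      | nil => simp
      | cons y l =>
        simp only [List.isChain_cons_cons] at h h2 ⊢
        exact ⟨⟨h2.1, h.1⟩, ih h.2 h2.2⟩

theorem gen_eq_zero {n : ℤ} (l : List G.V) (h : ¬ l.IsChain (· ≠ ·)) : gen R G n l = 0 :=
  dif_neg fun h' => h (h'.2.2.imp fun _ _ h => h.1)

theorem bdry_eq (n : ℤ) : bdry R G n = altSum R (gen R G n) := rfl

/-- A linear map given on generators by a function that vanishes on degenerate tuples. -/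
theorem linearCombination_gen {M : Type*} [AddCommGroup M] [Module R M] (g : List G.V → M)
    {n : ℤ} (h0 : g [] = 0) {l : List G.V} (h : l.IsChain G.Reachable)
    (hn : (l.length : ℤ) = n + 1) (hg : ¬ l.IsChain (· ≠ ·) → g l = 0) :
    Finsupp.linearCombination R (fun l : {l : List G.V // G.IsGen n l} => g l.1) (gen R G n l)
      = g l := by
  by_cases h' : G.IsGen n l
  · simp [gen, h']
  · rw [gen, dif_neg h', map_zero]
    rw [isGen_iff h hn, not_and_or, not_not] at h'
    rcases h' with rfl | h'
    · exact h0.symm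
    · exact (hg h').symm

theorem RCd_gen (m n : ℤ) {l : List G.V} (h : l.IsChain G.Reachable)
    (hm : (l.length : ℤ) = m + 1) : RCd R G m n (gen R G m l) = bdry R G n l :=
  linearCombination_gen (bdry R G n) (by simp [bdry]) h hm
    (altSum_degenerate _ gen_eq_zero l)

theorem RCmap_gen (f : G ⟶ H) (n : ℤ) {l : List G.V} (h : l.IsChain G.Reachable)
    (hn : (l.length : ℤ) = n + 1) :
    RCmap R f n (gen R G n l) = gen R H n (l.map f.toFun) := by
  refine linearCombination_gen (fun l => gen R H n (l.map f.toFun))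
    (dif_neg fun h => h.1 rfl) h hn fun h => gen_eq_zero _ fun h' => h ?_
  exact List.isChain_of_isChain_map f.toFun (fun _ _ h e => h (congrArg _ e)) h'

theorem RCd_shape (m n : ℤ) (h : n + 1 ≠ m) : RCd R G m n = 0 := by
  refine Finsupp.lhom_ext' fun l => LinearMap.ext_ring ?_
  simp only [RCd, LinearMap.comp_apply, Finsupp.lsingle_apply, Finsupp.linearCombination_single,
    one_smul, LinearMap.zero_apply, bdry]
  refine Finset.sum_eq_zero fun k hk => ?_
  have hl := l.2.2.1
  rw [gen, dif_neg, smul_zero]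
  intro h'
  have h1 := h'.2.1
  rw [List.length_eraseIdx_of_lt (Finset.mem_range.1 hk)] at h1
  have := Finset.mem_range.1 hk
  omega

theorem length_eraseIdx_cast {l : List G.V} {k : ℕ} {n : ℤ} (hk : k ∈ Finset.range l.length)
    (hl : (l.length : ℤ) = n + 1 + 1) : ((l.eraseIdx k).length : ℤ) = n + 1 := by
  have := Finset.mem_range.1 hk
  rw [List.length_eraseIdx_of_lt this]
  omega

theorem RCd_comp (n k : ℤ) : RCd R G n k ∘ₗ RCd R G (n + 1) n = 0 := by
  refine Finsupp.lhom_ext' fun l => LinearMap.ext_ring ?_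
  simp only [LinearMap.comp_apply, Finsupp.lsingle_apply, LinearMap.zero_apply]
  rw [RCd, RCd, Finsupp.linearCombination_single, one_smul, ← RCd, bdry, map_sum]
  rw [← altSum_altSum (R := R) (gen R G k) l.1, ← bdry_eq, altSum]
  refine Finset.sum_congr rfl fun a ha => ?_
  rw [map_smul, RCd_gen _ _ (isChain_eraseIdx l.2.isChain a) (length_eraseIdx_cast ha l.2.2.1)]

theorem RCmap_comm (f : G ⟶ H) (n : ℤ) :
    RCd R H (n + 1) n ∘ₗ RCmap R f (n + 1) = RCmap R f n ∘ₗ RCd R G (n + 1) n := by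
  refine Finsupp.lhom_ext' fun l => LinearMap.ext_ring ?_
  simp only [LinearMap.comp_apply, Finsupp.lsingle_apply]
  have hc : (l.1.map f.toFun).IsChain H.Reachable :=
    List.isChain_map_of_isChain f.toFun (fun _ _ h => Reachable.map f h) l.2.isChain
  rw [RCmap, Finsupp.linearCombination_single, one_smul,
    RCd_gen _ _ hc (by simpa using l.2.2.1)]
  rw [RCd, Finsupp.linearCombination_single, one_smul, bdry, bdry, map_sum, List.length_map]
  refine Finset.sum_congr rfl fun a ha => ?_
  rw [map_smul, RCmap_gen _ _ (isChain_eraseIdx l.2.isChain a) (length_eraseIdx_cast ha l.2.2.1),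
    List.eraseIdx_map]

theorem RCF_mono {p p' : ℤ} (h : p ≤ p') (n : ℤ) : RCF R G p n ≤ RCF R G p' n :=
  Finsupp.supported_mono fun _ ⟨m, hm, hl⟩ => ⟨m, hm.trans h, hl⟩

theorem gen_mem_RCF {p n : ℤ} {l : List G.V} {m : ℕ} (hm : (m : ℤ) ≤ p) (hl : G.length l ≤ m) :
    gen R G n l ∈ RCF R G p n := by
  rw [gen]
  split_ifs with h
  · exact Finsupp.single_mem_supported R _ ⟨m, hm, hl⟩
  · exact zero_mem _

theorem linearCombination_mem {M : Type*} [AddCommGroup M] [Module R M] {p n : ℤ}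
    (g : {l : List G.V // G.IsGen n l} → M) (S : Submodule R M)
    (hg : ∀ l (m : ℕ), (m : ℤ) ≤ p → G.length l.1 ≤ m → g l ∈ S) {x : RC R G n}
    (hx : x ∈ RCF R G p n) : Finsupp.linearCombination R g x ∈ S := by
  rw [Finsupp.linearCombination_apply]
  refine Submodule.sum_mem _ fun l hl => S.smul_mem _ ?_
  obtain ⟨m, hm, h⟩ := (Finsupp.mem_supported R x).1 hx hl
  exact hg l m hm h

theorem RCd_mem {p m n : ℤ} {x : RC R G m} (hx : x ∈ RCF R G p m) :
    RCd R G m n x ∈ RCF R G p n := by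
  refine linearCombination_mem (fun l => bdry R G n l.1) (RCF R G p n) ?_ hx
  intro l t hm hl
  refine Submodule.sum_mem _ fun k _ => Submodule.smul_mem _ _ ?_
  exact gen_mem_RCF hm ((length_eraseIdx_le l.1 k).trans hl)

theorem RCmap_mem (f : G ⟶ H) {p n : ℤ} {x : RC R G n} (hx : x ∈ RCF R G p n) :
    RCmap R f n x ∈ RCF R H p n := by
  refine linearCombination_mem (fun l => gen R H n (l.1.map f.toFun)) (RCF R H p n) ?_ hx
  intro l t hm hl
  exact gen_mem_RCF hm ((length_map_le f l.1).trans hl)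

theorem RCmap_comp {K : DiGraph.{u}} (f : G ⟶ H) (g : H ⟶ K) (n : ℤ) :
    RCmap R (f ≫ g) n = RCmap R g n ∘ₗ RCmap R f n := by
  refine Finsupp.lhom_ext' fun l => LinearMap.ext_ring ?_
  simp only [LinearMap.comp_apply, Finsupp.lsingle_apply]
  have hc : (l.1.map f.toFun).IsChain H.Reachable :=
    List.isChain_map_of_isChain f.toFun (fun _ _ h => Reachable.map f h) l.2.isChain
  rw [RCmap, RCmap, RCmap, Finsupp.linearCombination_single, one_smul,
    Finsupp.linearCombination_single, one_smul, ← RCmap,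
    RCmap_gen g n hc (by simpa using l.2.2.1), List.map_map]
  rfl

theorem RCmap_comm' (f : G ⟶ H) (m n : ℤ) :
    RCd R H m n ∘ₗ RCmap R f m = RCmap R f n ∘ₗ RCd R G m n := by
  by_cases h : n + 1 = m
  · subst h; exact RCmap_comm f n
  · simp [RCd_shape _ _ h]

/-! ### Relative reachability chains and the relative magnitude-path spectral sequence -/

variable (R)

variable {A X Y P : DiGraph.{u}}

/-- The differential of the quotient `RC(X) / RC(A)`. -/
noncomputable def relD (i : A ⟶ X) (m n : ℤ) :
    (RC R X m ⧸ LinearMap.range (RCmap R i m)) →ₗ[R]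
      (RC R X n ⧸ LinearMap.range (RCmap R i n)) :=
  Submodule.mapQ _ _ (RCd R X m n) (by
    rintro _ ⟨y, rfl⟩
    exact ⟨RCd R A m n y, (LinearMap.congr_fun (RCmap_comm' (R := R) i m n) y).symm⟩)

/-- For `i : A ⟶ X` the inclusion of a subgraph, the relative reachability chain complex
`RC(X,A) = RC(X) / RC(A)`, where `F_p RC(X,A)` is the image of `F_p RC(X)`. -/
noncomputable def relRC (i : A ⟶ X) : FilteredComplex.{max u w} R where
  C :=
    { X := fun n => ModuleCat.of R (RC R X n ⧸ LinearMap.range (RCmap R i n))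
      d := fun m n => ModuleCat.ofHom (relD R i m n)
      shape := fun m n h => by
        ext1
        refine Submodule.linearMap_qext _ (LinearMap.ext fun x => ?_)
        simp [relD, RCd_shape m n h]
      d_comp_d' := fun m n k h _ => by
        ext1
        obtain rfl : n + 1 = m := h
        refine Submodule.linearMap_qext _ (LinearMap.ext fun x => ?_)
        have := LinearMap.congr_fun (RCd_comp (R := R) (G := X) n k) x
        simp only [LinearMap.comp_apply, LinearMap.zero_apply] at this
        simp [relD, this] }
  F := fun p n => (RCF R X p n).map (Submodule.mkQ _)
  mono := fun h n => Submodule.map_mono (RCF_mono h n)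
  d_mem := by
    rintro p m n _ ⟨x, hx, rfl⟩
    exact ⟨RCd R X m n x, RCd_mem hx, rfl⟩

/-- The filtered chain map `RC(X,A) → RC(P,Y)` induced by a commutative square. -/
noncomputable def relRCmap {i : A ⟶ X} {f : A ⟶ Y} {g : X ⟶ P} {j : Y ⟶ P}
    (sq : i ≫ g = f ≫ j) : (relRC R i).Hom (relRC R j) where
  φ :=
    { f := fun n => ModuleCat.ofHom (Submodule.mapQ _ _ (RCmap R g n) (by
        rintro _ ⟨y, rfl⟩
        refine ⟨RCmap R f n y, ?_⟩
        rw [← LinearMap.comp_apply, ← RCmap_comp, ← sq, RCmap_comp, LinearMap.comp_apply]))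
      comm' := fun m n _ => by
        ext1
        refine Submodule.linearMap_qext _ (LinearMap.ext fun x => ?_)
        have := LinearMap.congr_fun (RCmap_comm' (R := R) g m n) x
        exact congrArg (Submodule.mkQ (LinearMap.range (RCmap R j n))) this }
  map_mem := by
    rintro p n _ ⟨x, hx, rfl⟩
    exact ⟨RCmap R g n x, RCmap_mem g hx, rfl⟩

/-- The relative magnitude-path spectral sequence `E^r_{p,q}(X,A)`, where `A` is included
in `X` by `i`. -/
abbrev relE (i : A ⟶ X) (r : ℕ) (p q : ℤ) : Type (max u w) := (relRC R i).E r p q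

/-- The differential `d^r : E^r_{p,q}(X,A) → E^r_{p-r,q+r-1}(X,A)`. -/
noncomputable def relEd (i : A ⟶ X) (r : ℕ) (p q : ℤ) :
    relE R i r p q →ₗ[R] relE R i r (p - r) (q + r - 1) :=
  (relRC R i).dE r p q

/-- The map `E^r_{p,q}(X,A) → E^r_{p,q}(P,Y)` induced by a commutative square. -/
noncomputable def relEmap {i : A ⟶ X} {f : A ⟶ Y} {g : X ⟶ P} {j : Y ⟶ P}
    (sq : i ≫ g = f ≫ j) (r : ℕ) (p q : ℤ) : relE R i r p q →ₗ[R] relE R j r p q :=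
  (relRCmap R sq).mapE r p q

/-- Relative magnitude homology `MH_{k,l}(X,A) = E^1_{l,k-l}(X,A)`. -/
abbrev relMH (i : A ⟶ X) (k l : ℤ) : Type (max u w) := relE R i 1 l (k - l)

/-- The map induced on relative magnitude homology. -/
noncomputable def relMHmap {i : A ⟶ X} {f : A ⟶ Y} {g : X ⟶ P} {j : Y ⟶ P}
    (sq : i ≫ g = f ≫ j) (k l : ℤ) : relMH R i k l →ₗ[R] relMH R j k l :=
  relEmap R sq 1 l (k - l)

/-- Relative bigraded path homology `PH_{k,l}(X,A) = E^2_{l,k-l}(X,A)`. -/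
abbrev relPH (i : A ⟶ X) (k l : ℤ) : Type (max u w) := relE R i 2 l (k - l)

/-- The map induced on relative bigraded path homology. -/
noncomputable def relPHmap {i : A ⟶ X} {f : A ⟶ Y} {g : X ⟶ P} {j : Y ⟶ P}
    (sq : i ≫ g = f ≫ j) (k l : ℤ) : relPH R i k l →ₗ[R] relPH R j k l :=
  relEmap R sq 2 l (k - l)

end DiGraph

/-! The chain map from `RC(X,A)` to `RC(P,Y)` is a homotopy equivalence whose inverse and homotopies
all preserve the filtration, and such a map is bijective on every page from the first on
(`FilteredComplex.Hom.mapE_bijective`).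

Since no edge enters `A` from outside, a generating tuple is a block in `A` followed by a block
outside `A`. Let `h` send a tuple starting in `A` to the alternating sum of the tuples
`(πx₀,…,πx_k,x_k,…,xₙ)`, and all other tuples to zero. The projection identity and `πx₀ = x₀` keep
`h` from increasing lengths. The full prism is a homotopy from the identity to `π`, and `π` of a
tuple starting in `A` vanishes modulo `A`. Restricting the prism to tuples starting in `A` changes
only the face omitting `x₀`, so `id - ∂h - h∂` is the operator `collapse` (`sub_collapse`): the
identity on tuples outside `A`, the prism on `(x₁,…,xₙ)` when `x₀` is the only entry in `A`, and
zero otherwise.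

The decisive point is that `collapse` forgets `x₀`. The same formula therefore makes sense on
`RC(P,Y)`, where the first entry need not come from `A`, with values in `RC(X,A)`, because vertices
of `P` outside `Y` lift uniquely to `X` outside `A`. It is a chain map (`collapse_altSum`), and it
is filtered because the first step out of `Y` pays for the inserted projection
(`IsCollapse.length_prismFace_le`). Both composites with the induced map are again `collapse`
operators (`IsExcisive.collapse_map`, `IsExcisive.map_collapse`), hence homotopic to the identity.

The metric input comes from an explicit model of the pushout. A path from `y` in `Y` to `x` outside
`A` leaves `Y` once, at some `f a`. Rerouting it through `f b` with `b = π(x)` does not lengthen it,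
since `f` does not increase distances (`dist_add_dist_le_pushout`). So `Y` in `P` has projections
too, for arbitrary `f`. -/

/-! ### Filtered homotopy equivalences -/

namespace FilteredComplex

variable {R : Type w} [CommRing R] {K L : FilteredComplex.{v} R}

theorem d_add_mem_B {r p n : ℤ} (hr : 1 ≤ r) {u : K.C.X (n + 1)} {v : K.C.X n}
    (hu : u ∈ K.F p (n + 1)) (hv : v ∈ K.F (p - r) n) :
    (K.C.d (n + 1) n).hom u + v ∈ K.B r p n := by
  rw [add_comm]
  -- The inclusions of `F_{p-r}` in `F_{p-1}` and of `F_p` in `F_{p+r-1}` need `r ≥ 1`; this is why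
  -- the statement starts at the first page. The boundary conditions hold because `(p-1)-(r-1) =
  -- p-r` and `(p+r-1)-(r-1) = p`.
  refine add_mem (Submodule.mem_sup_left ⟨K.mono (by omega) n hv, ?_⟩)
    (Submodule.mem_sup_right ⟨u, ⟨K.mono (by omega) _ hu, ?_⟩, rfl⟩)
  · exact K.mono (by omega) _ (K.d_mem _ _ (n - 1) _ hv)
  · exact K.mono (by omega) _ (K.d_mem _ _ (n + 1 - 1) _ hu)

/-- The composite of `h` and `k` is homotopic to the identity of `K` through a homotopy `s`
that preserves the filtration. -/
structure IsHomotopyInverse (h : K.Hom L) (k : L.Hom K)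
    (s : ∀ m n, K.C.X m →ₗ[R] K.C.X n) : Prop where
  map_mem : ∀ {p n : ℤ} {x : K.C.X n}, x ∈ K.F p n → s n (n + 1) x ∈ K.F p (n + 1)
  eq : ∀ (n : ℤ) (x : K.C.X n), x - (k.φ.f n).hom ((h.φ.f n).hom x) =
    (K.C.d (n + 1) n).hom (s n (n + 1) x) + s (n - 1) n ((K.C.d n (n - 1)).hom x)

/-- The homotopy does not raise filtration, so `s x` stays in `F_p` and `s ∂x` stays in `F_{p-r}`.
-/
theorem IsHomotopyInverse.sub_mem_B {h : K.Hom L} {k : L.Hom K}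
    {s : ∀ m n, K.C.X m →ₗ[R] K.C.X n} (hs : IsHomotopyInverse h k s) {r p n : ℤ} (hr : 1 ≤ r)
    {x : K.C.X n} (hx : x ∈ K.Z r p n) :
    x - (k.φ.f n).hom ((h.φ.f n).hom x) ∈ K.B r p n := by
  rw [hs.eq]
  refine d_add_mem_B hr (hs.map_mem hx.1) ?_
  have := hs.map_mem (n := n - 1) hx.2
  rwa [show n - 1 + 1 = n by ring] at this

/-- A filtered homotopy equivalence induces isomorphisms on all pages from the first on. -/
theorem Hom.mapE_bijective {h : K.Hom L} {k : L.Hom K}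
    {s : ∀ m n, K.C.X m →ₗ[R] K.C.X n} {t : ∀ m n, L.C.X m →ₗ[R] L.C.X n}
    (hs : IsHomotopyInverse h k s) (ht : IsHomotopyInverse k h t) {r : ℕ} (hr : 1 ≤ r) (p q : ℤ) :
    Function.Bijective (h.mapE r p q) := by
  have hr' : (1 : ℤ) ≤ r := by exact_mod_cast hr
  constructor
  · rw [injective_iff_map_eq_zero]
    intro x hx
    obtain ⟨⟨z, hz⟩, rfl⟩ := Submodule.Quotient.mk_surjective _ x
    have hB : (h.φ.f (p + q)).hom z ∈ L.B r p (p + q) :=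
      (Submodule.Quotient.mk_eq_zero ((L.B r p (p + q)).submoduleOf (L.Z r p (p + q)))).1 hx
    refine (Submodule.Quotient.mk_eq_zero _).2 ?_
    -- Decompose `z = (z - khz) + khz`; the second summand is the image under `k` of an element of
    -- `B`.
    have := add_mem (hs.sub_mem_B hr' hz) (k.map_mem_B hB)
    rwa [sub_add_cancel] at this
  · intro y
    obtain ⟨⟨z, hz⟩, rfl⟩ := Submodule.Quotient.mk_surjective _ y
    refine ⟨Submodule.Quotient.mk ⟨(k.φ.f (p + q)).hom z, k.map_mem_Z hz⟩, ?_⟩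
    refine ((Submodule.Quotient.eq _).2 ?_).symm
    exact ht.sub_mem_B hr' hz

theorem Hom.mapE_dE (h : K.Hom L) (r : ℕ) (p q : ℤ) (x : K.E r p q) :
    h.mapE r (p - r) (q + r - 1) (K.dE r p q x) = L.dE r p q (h.mapE r p q x) := by
  obtain ⟨⟨z, hz⟩, rfl⟩ := Submodule.Quotient.mk_surjective _ x
  refine congrArg Submodule.Quotient.mk (Subtype.ext ?_)
  exact (h.comm_apply _ _ z).symm

end FilteredComplex

/-! ### Prism operators on lists -/

namespace DiGraph

section Prism

variable {R : Type w} [CommRing R] {M N : Type*} [AddCommGroup M] [Module R M]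
  [AddCommGroup N] [Module R N] {α β : Type*}

/-- The list `(π x₀, …, π x_k, ι x_k, …, ι x_n)`. -/
def prismFace (ι π : α → β) : List α → ℕ → List β
  | [], _ => []
  | x :: l, 0 => π x :: ι x :: l.map ι
  | x :: l, k + 1 => π x :: prismFace ι π l k

variable (R) in
/-- The alternating sum of the values of `g` on the lists `(π x₀, …, π x_k, ι x_k, …, ι x_n)`. -/
def prismSum (ι π : α → β) (g : List β → M) (l : List α) : M :=
  ∑ k ∈ Finset.range l.length, (-1 : R) ^ k • g (prismFace ι π l k)

variable {ι π : α → β}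

@[simp]
theorem prismSum_nil (g : List β → M) : prismSum R ι π g [] = 0 := by simp [prismSum]

theorem prismSum_cons (g : List β → M) (x : α) (l : List α) :
    prismSum R ι π g (x :: l) =
      g (π x :: ι x :: l.map ι) - prismSum R ι π (fun m => g (π x :: m)) l := by
  simp only [prismSum, List.length_cons, Finset.sum_range_succ', prismFace,
    pow_zero, one_smul, pow_succ, mul_neg, mul_one, neg_smul, Finset.sum_neg_distrib]
  abel

theorem prismSum_sub (g h : List β → M) (l : List α) :
    prismSum R ι π (fun m => g m - h m) l = prismSum R ι π g l - prismSum R ι π h l := by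
  simp [prismSum, smul_sub]

theorem map_prismSum (φ : M →ₗ[R] N) (g : List β → M) (l : List α) :
    φ (prismSum R ι π g l) = prismSum R ι π (fun m => φ (g m)) l := by
  simp [prismSum]

theorem map_altSum (φ : M →ₗ[R] N) (g : List α → M) (l : List α) :
    φ (altSum R g l) = altSum R (fun m => φ (g m)) l := by
  simp [altSum]

theorem prismSum_congr {g h : List β → M} {l : List α}
    (H : ∀ k < l.length, g (prismFace ι π l k) = h (prismFace ι π l k)) :
    prismSum R ι π g l = prismSum R ι π h l :=
  Finset.sum_congr rfl fun k hk => by rw [H k (Finset.mem_range.1 hk)]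

theorem altSum_congr {g h : List α → M} {l : List α}
    (H : ∀ k < l.length, g (l.eraseIdx k) = h (l.eraseIdx k)) :
    altSum R g l = altSum R h l :=
  Finset.sum_congr rfl fun k hk => by rw [H k (Finset.mem_range.1 hk)]

theorem altSum_map (f : α → β) (g : List β → M) (l : List α) :
    altSum R g (l.map f) = altSum R (fun m => g (m.map f)) l := by
  simp [altSum, List.eraseIdx_map]

/-- The prism operator is a homotopy between the maps induced by `ι` and `π`. -/
theorem prismSum_altSum (g : List β → M) (l : List α) :
    prismSum R ι π (altSum R g) l + altSum R (prismSum R ι π g) l =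
      g (l.map ι) - g (l.map π) := by
  induction l generalizing g with
  | nil => simp [altSum]
  | cons x l ih =>
    -- Every prism list except the first begins with `π x`, so the tail is handled by the hypothesis
    -- for `g` precomposed with prefixing `π x`.
    have h := ih fun m => g (π x :: m)
    rw [prismSum_cons, altSum_cons, altSum_cons, altSum_cons]
    simp only [altSum_cons, prismSum_cons, prismSum_sub, altSum_sub, List.map_cons, altSum_map]
    rw [← sub_eq_zero] at h ⊢
    rw [← h]
    abel

theorem length_prismFace {l : List α} {k : ℕ} (hk : k < l.length) :
    (prismFace ι π l k).length = l.length + 1 := by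
  induction l generalizing k with
  | nil => simp at hk
  | cons x l ih =>
    cases k with
    | zero => simp [prismFace]
    | succ k => simp [prismFace, ih (Nat.lt_of_succ_lt_succ hk)]

/-- A repetition at places `m`, `m + 1` persists in every prism list: as two adjacent values of `ι`
if the switch occurs at `k ≤ m`, and of `π` if `k > m`. -/
theorem isChain_ne_of_prismFace {l : List α} {k : ℕ} (hk : k < l.length)
    (h : (prismFace ι π l k).IsChain (· ≠ ·)) : l.IsChain (· ≠ ·) := by
  induction l generalizing k with
  | nil => simp
  | cons x l ih =>
    cases k with
    | zero =>
      refine List.isChain_of_isChain_map ι (fun _ _ h e => h (congrArg _ e)) (?_ :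
        ((x :: l).map ι).IsChain (· ≠ ·))
      exact h.tail
    | succ k =>
      cases l with
      | nil => simp
      | cons y l =>
        refine List.isChain_cons_cons.2 ⟨?_, ih (Nat.lt_of_succ_lt_succ hk) h.tail⟩
        rintro rfl
        cases k <;> simp [prismFace] at h

theorem prismSum_degenerate {g : List β → M} (hg : ∀ l, ¬ l.IsChain (· ≠ ·) → g l = 0)
    {l : List α} (hl : ¬ l.IsChain (· ≠ ·)) : prismSum R ι π g l = 0 :=
  Finset.sum_eq_zero fun k hk => by
    rw [hg _ fun h => hl (isChain_ne_of_prismFace (Finset.mem_range.1 hk) h), smul_zero]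

theorem prismFace_map {γ : Type*} (f : β → γ) (l : List α) (k : ℕ) :
    (prismFace ι π l k).map f = prismFace (f ∘ ι) (f ∘ π) l k := by
  induction l generalizing k with
  | nil => rfl
  | cons x l ih => cases k <;> simp [prismFace, ih]

theorem prismFace_comp {γ : Type*} (f : γ → α) (l : List γ) (k : ℕ) :
    prismFace ι π (l.map f) k = prismFace (ι ∘ f) (π ∘ f) l k := by
  induction l generalizing k with
  | nil => rfl
  | cons x l ih => cases k <;> simp [prismFace, ih]

theorem prismFace_congr {ι' π' : α → β} {l : List α} (h : ∀ x ∈ l, ι x = ι' x)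
    (h' : ∀ x ∈ l, π x = π' x) (k : ℕ) : prismFace ι π l k = prismFace ι' π' l k := by
  induction l generalizing k with
  | nil => rfl
  | cons x l ih =>
    have hx := h x (by simp)
    have hx' := h' x (by simp)
    have e := ih (fun y hy => h y (by simp [hy])) (fun y hy => h' y (by simp [hy]))
    cases k with
    | zero => simpa [prismFace, hx, hx'] using fun y hy => h y (by simp [hy])
    | succ k => simp [prismFace, hx', e]

/-! ### Prism operators restricted by the first entry -/

open Classical in
variable (R) in
/-- The prism operator on lists starting in `S`, zero on the other lists. -/
noncomputable def prismOn (S : Set α) (π : α → α) (g : List α → M) : List α → M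
  | [] => 0
  | x :: l => if x ∈ S then prismSum R id π g (x :: l) else 0

open Classical in
variable (R) in
/-- The prism operator on lists not starting in `S`, zero on the other lists. -/
noncomputable def prismOff (S : Set α) (ι π : α → β) (g : List β → M) : List α → M
  | [] => 0
  | x :: l => if x ∈ S then 0 else prismSum R ι π g (x :: l)

open Classical in
variable (R) in
/-- The operator that sends a list outside `S` to its image under `ι`, a list with exactly one
entry in `S` (the first) to the prism on its remaining entries, and all other lists to zero. -/
noncomputable def collapse (S : Set α) (ι π : α → β) (g : List β → M) : List α → M
  | [] => 0
  | x :: l => if x ∈ S then prismOff R S ι π g l else g (ι x :: l.map ι)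

variable {S : Set α}

theorem prismOn_cons_of_mem {π : α → α} {g : List α → M} {x : α} (h : x ∈ S) (l : List α) :
    prismOn R S π g (x :: l) = prismSum R id π g (x :: l) := if_pos h

theorem prismOn_add_prismOff (π : α → α) (g : List α → M) (l : List α) :
    prismOn R S π g l + prismOff R S id π g l = prismSum R id π g l := by
  cases l with
  | nil => simp [prismOn, prismOff]
  | cons x l => by_cases h : x ∈ S <;> simp [prismOn, prismOff, h]

theorem prismOff_eq {g : List β → M} {l : List α} (h : ∀ x ∈ l, x ∉ S) :
    prismOff R S ι π g l = prismSum R ι π g l := by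
  cases l with
  | nil => simp [prismOff]
  | cons x l => simp [prismOff, h x (by simp)]

theorem collapse_eq {g : List β → M} (h0 : g [] = 0) {l : List α} (h : ∀ x ∈ l, x ∉ S) :
    collapse R S ι π g l = g (l.map ι) := by
  cases l with
  | nil => simp [collapse, h0]
  | cons x l => simp [collapse, h x (by simp)]

/-- On lists that stay outside `S` once they have left it,
`collapse` is homotopic to the identity. -/
theorem sub_collapse {π : α → α} {g : List α → M} (h0 : g [] = 0) {l : List α}
    (hl : (∃ x ∈ l.head?, x ∈ S) ∨ ∀ x ∈ l, x ∉ S)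
    (hg : (∃ x ∈ l.head?, x ∈ S) → g (l.map π) = 0) :
    g l - collapse R S id π g l =
      prismOn R S π (altSum R g) l + altSum R (prismOn R S π g) l := by
  rcases hl with h | h
  · cases l with
    | nil => simp at h
    | cons x l =>
      have hx : x ∈ S := by simpa using h
      have e := prismSum_altSum (R := R) (ι := id) (π := π) g (x :: l)
      rw [hg h, List.map_id, sub_zero, altSum_cons] at e
      rw [altSum_cons, ← e]
      simp only [collapse, prismOn_cons_of_mem hx, hx, if_true]
      -- Faces other than `l` still begin with `x ∈ S` and see the full prism. On `l` the restricted
      -- prism misses exactly the `prismOff` part, which is the value of `collapse`.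
      rw [← prismOn_add_prismOff (S := S) π g l]
      abel
  · rw [collapse_eq h0 h, List.map_id, sub_self]
    cases l with
    | nil => simp [prismOn, altSum]
    | cons x l =>
      have hx : x ∉ S := h x (by simp)
      rw [altSum_cons]
      simp only [prismOn, hx, if_false]
      cases l with
      | nil => simp [altSum]
      | cons y l => simp [altSum, h y (by simp)]

/-- On lists that stay outside `S` once they have left it, `collapse` commutes with boundaries. -/
theorem collapse_altSum {g : List β → M} (h0 : g [] = 0) {l : List α}
    (hl : ∀ x l', l = x :: l' → x ∉ S → ∀ y ∈ l', y ∉ S)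
    (hl' : ∀ x y l', l = x :: y :: l' → x ∈ S → y ∉ S →
      (∀ z ∈ l', z ∉ S) ∧ g ((y :: l').map π) = 0) :
    collapse R S ι π (altSum R g) l = altSum R (collapse R S ι π g) l := by
  cases l with
  | nil => simp [collapse, altSum]
  | cons x l =>
    by_cases hx : x ∈ S
    · cases l with
      | nil => simp [collapse, altSum, prismOff, hx]
      | cons y l =>
        by_cases hy : y ∈ S
        -- The faces omitting `x` and omitting `y` cancel, because `collapse` ignores which element
        -- of `S` comes first; the remaining faces still begin with two entries in `S`.
        · simp [altSum_cons, collapse, prismOff, hx, hy]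
          simp [altSum]
        · obtain ⟨h, hg⟩ := hl' x y l rfl hx hy
          have h' : ∀ z ∈ y :: l, z ∉ S := by simpa [hy] using h
          -- In the prism formula for `y :: l` the `π` term is zero, and the `ι` term is the value
          -- of `collapse` on the face that omits `x`.
          have e := prismSum_altSum (R := R) (ι := ι) (π := π) g (y :: l)
          rw [hg, sub_zero] at e
          rw [altSum_cons, collapse_eq h0 h', ← e]
          simp only [collapse, hx, if_true]
          rw [prismOff_eq h', eq_sub_iff_add_eq]
          congr 1
          refine altSum_congr fun k _ => prismOff_eq fun z hz => ?_
          exact h' z ((List.eraseIdx_sublist _ _).subset hz)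
    · have h' : ∀ z ∈ x :: l, z ∉ S := by simpa [hx] using hl x l rfl hx
      rw [collapse_eq (by simp [altSum]) h', altSum_map]
      refine altSum_congr fun k _ => (collapse_eq h0 fun z hz => ?_).symm
      exact h' z ((List.eraseIdx_sublist _ _).subset hz)

theorem prismOn_degenerate {π : α → α} {g : List α → M}
    (hg : ∀ l, ¬ l.IsChain (· ≠ ·) → g l = 0)
    {l : List α} (hl : ¬ l.IsChain (· ≠ ·)) : prismOn R S π g l = 0 := by
  cases l with
  | nil => rfl
  | cons x l => simp [prismOn, prismSum_degenerate hg hl]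

theorem prismOff_degenerate {g : List β → M} (hg : ∀ l, ¬ l.IsChain (· ≠ ·) → g l = 0)
    {l : List α} (hl : ¬ l.IsChain (· ≠ ·)) : prismOff R S ι π g l = 0 := by
  cases l with
  | nil => rfl
  | cons x l => simp [prismOff, prismSum_degenerate hg hl]

/-- A repetition cannot straddle the passage out of `S`. It lies in the part that `collapse`
retains, or else the list begins with two entries in `S` and is killed anyway. -/
theorem collapse_degenerate {g : List β → M} (hg : ∀ l, ¬ l.IsChain (· ≠ ·) → g l = 0)
    {l : List α} (hl : ¬ l.IsChain (· ≠ ·)) : collapse R S ι π g l = 0 := by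
  cases l with
  | nil => rfl
  | cons x l =>
    by_cases hx : x ∈ S
    · simp only [collapse, hx, if_true]
      cases l with
      | nil => rfl
      | cons y l =>
        by_cases hy : y ∈ S
        · simp [prismOff, hy]
        · refine prismOff_degenerate hg fun h => hl (List.isChain_cons_cons.2 ⟨?_, h⟩)
          rintro rfl
          exact hy hx
    · simp only [collapse, hx, if_false]
      refine hg _ fun h => hl ?_
      exact List.isChain_of_isChain_map ι (fun _ _ h e => h (congrArg _ e)) (l := x :: l) h

end Prism

end DiGraph

namespace DiGraph

/-! ### Distances and lengths -/

section Length

variable {G H : DiGraph.{u}}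

theorem dist_ne_top_iff {x y : G.V} : G.dist x y ≠ ⊤ ↔ G.Reachable x y := by
  constructor
  · intro h
    by_contra hr
    refine h (iInf₂_eq_top.2 fun n hn => (hr ⟨n, hn⟩).elim)
  · rintro ⟨n, hn⟩
    exact ne_top_of_le_ne_top (ENat.natCast_ne_top n) (dist_le hn)

theorem dist_self (x : G.V) : G.dist x x = 0 :=
  nonpos_iff_eq_zero.1 (dist_le (n := 0) (show G.HasPath 0 x x from rfl))

/-- This lets each length estimate for prism tuples serve twice: it bounds the filtration degree and
shows that consecutive entries are reachable. -/
theorem length_ne_top_iff {l : List G.V} : G.length l ≠ ⊤ ↔ l.IsChain G.Reachable := by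
  induction l with
  | nil => simp [length]
  | cons x l ih =>
    cases l with
    | nil => simp [length]
    | cons y l =>
      rw [List.isChain_cons_cons, ← ih, ← dist_ne_top_iff, length, ne_eq, ENat.add_eq_top, not_or]

theorem length_map_le_of {ι : G.V → H.V} {W : Set G.V}
    (hι : ∀ x ∈ W, ∀ y ∈ W, H.dist (ι x) (ι y) ≤ G.dist x y) {l : List G.V}
    (hl : ∀ x ∈ l, x ∈ W) : H.length (l.map ι) ≤ G.length l := by
  induction l with
  | nil => exact le_rfl
  | cons x l ih =>
    cases l with
    | nil => exact le_rfl
    | cons y l =>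
      have := ih fun z hz => hl z (by simp [hz])
      simp only [List.map_cons, length] at this ⊢
      gcongr
      exact hι x (hl x (by simp)) y (hl y (by simp))

/-- The detour `πx → πy → ιy` costs at most `d(πx,ιy)`, hence at most `d(πx,ιx) + d(ιx,ιy)`. The
overhead at `y` is thus traded for the overhead at `x`, and by induction only the overhead at the
first entry remains. -/
theorem length_prismFace_le {ι π : G.V → H.V} {W : Set G.V}
    (hι : ∀ x ∈ W, ∀ y ∈ W, H.dist (ι x) (ι y) ≤ G.dist x y)
    (hπ : ∀ x ∈ W, ∀ y ∈ W,
      H.dist (π x) (π y) + H.dist (π y) (ι y) ≤ H.dist (π x) (ι y))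
    {x : G.V} {l : List G.V} (hl : ∀ y ∈ x :: l, y ∈ W) {k : ℕ} (hk : k < (x :: l).length) :
    H.length (prismFace ι π (x :: l) k) ≤ H.dist (π x) (ι x) + G.length (x :: l) := by
  induction l generalizing x k with
  | nil =>
    obtain rfl : k = 0 := by simpa using hk
    simp [prismFace, length]
  | cons y l ih =>
    cases k with
    | zero =>
      have := length_map_le_of hι hl
      simp only [prismFace, List.map_cons] at this ⊢
      rw [length]
      gcongr
    | succ k =>
      have hx : x ∈ W := hl x (by simp)
      have hy : y ∈ W := hl y (by simp)
      have h := ih (x := y) (fun z hz => hl z (by simp [hz])) (Nat.lt_of_succ_lt_succ hk)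
      have e : H.length (prismFace ι π (x :: y :: l) (k + 1)) =
          H.dist (π x) (π y) + H.length (prismFace ι π (y :: l) k) := by
        cases k <;> rfl
      rw [e, length]
      calc H.dist (π x) (π y) + H.length (prismFace ι π (y :: l) k)
          ≤ H.dist (π x) (π y) + (H.dist (π y) (ι y) + G.length (y :: l)) := by gcongr
        _ ≤ H.dist (π x) (ι y) + G.length (y :: l) := by
          rw [← add_assoc]; gcongr; exact hπ x hx y hy
        _ ≤ H.dist (π x) (ι x) + H.dist (ι x) (ι y) + G.length (y :: l) := by
          gcongr; exact dist_triangle _ _ _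
        _ ≤ H.dist (π x) (ι x) + (G.dist x y + G.length (y :: l)) := by
          rw [add_assoc]; gcongr; exact hι x hx y hy

theorem reachable_of_isChain {x : G.V} {l : List G.V} (h : (x :: l).IsChain G.Reachable)
    {y : G.V} (hy : y ∈ x :: l) : G.Reachable x y := by
  have : IsTrans G.V G.Reachable := ⟨fun _ _ _ => Reachable.trans⟩
  rcases List.mem_cons.1 hy with rfl | hy
  · exact ⟨0, rfl⟩
  · exact List.rel_of_pairwise_cons h.pairwise hy

end Length

/-! ### Relative chains -/

section Relative

variable {R : Type w} [CommRing R] {A X : DiGraph.{u}} {M : Type*} [AddCommGroup M] [Module R M]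

variable (R) in
/-- The class of the tuple `l` in `RC_n(X,A)`. -/
noncomputable def relGen (i : A ⟶ X) (n : ℤ) (l : List X.V) :
    RC R X n ⧸ LinearMap.range (RCmap R i n) :=
  Submodule.mkQ _ (gen R X n l)

theorem relGen_degenerate (i : A ⟶ X) (n : ℤ) (l : List X.V) (h : ¬ l.IsChain (· ≠ ·)) :
    relGen R i n l = 0 := by
  rw [relGen, gen_eq_zero l h, map_zero]

/-- The hypothesis `hi` is what makes a generator of `RC(X)` with entries in `A` come from a
generator of `RC(A)`. -/
theorem relGen_map (i : A ⟶ X)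
    (hi : ∀ a b, X.Reachable (i.toFun a) (i.toFun b) → A.Reachable a b) (n : ℤ) (l : List A.V) :
    relGen R i n (l.map i.toFun) = 0 := by
  by_cases h : X.IsGen n (l.map i.toFun)
  · refine (Submodule.Quotient.mk_eq_zero _).2 ⟨gen R A n l, RCmap_gen i n ?_ ?_⟩
    · exact List.isChain_of_isChain_map i.toFun hi h.isChain
    · simpa using h.2.1
  · rw [relGen, gen, dif_neg h, map_zero]

theorem relGen_mem (i : A ⟶ X) {p n : ℤ} {l : List X.V} {m : ℕ} (hm : (m : ℤ) ≤ p)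
    (hl : X.length l ≤ m) :
    relGen R i n l ∈ (RCF R X p n).map (LinearMap.range (RCmap R i n)).mkQ :=
  Submodule.mem_map_of_mem (gen_mem_RCF hm hl)

/-- A function on tuples that vanishes on the tuples in `A` defines a linear map on `RC(X,A)`. -/
noncomputable def relLift (i : A ⟶ X) (n : ℤ) (F : List X.V → M)
    (hF : ∀ l : List A.V, F (l.map i.toFun) = 0) :
    (RC R X n ⧸ LinearMap.range (RCmap R i n)) →ₗ[R] M :=
  Submodule.liftQ _ (Finsupp.linearCombination R fun l => F l.1) (by
    rw [LinearMap.range_le_ker_iff]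
    refine Finsupp.lhom_ext' fun l => LinearMap.ext_ring ?_
    simp only [LinearMap.comp_apply, Finsupp.lsingle_apply, LinearMap.zero_apply, RCmap,
      Finsupp.linearCombination_single, one_smul]
    rw [gen]
    split_ifs
    · rw [Finsupp.linearCombination_single, one_smul, hF]
    · exact map_zero _)

/-- The condition `hd` is needed because `relGen` is zero on degenerate tuples, so `F` has to agree
there. -/
theorem relLift_relGen {i : A ⟶ X} {n : ℤ} {F : List X.V → M}
    (hF : ∀ l : List A.V, F (l.map i.toFun) = 0) {l : List X.V} (h : l.IsChain X.Reachable)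
    (hn : (l.length : ℤ) = n + 1) (hd : ¬ l.IsChain (· ≠ ·) → F l = 0) :
    relLift (R := R) i n F hF (relGen R i n l) = F l :=
  linearCombination_gen F (hF []) h hn hd

theorem relLift_mem {i : A ⟶ X} {n p : ℤ} {F : List X.V → M}
    (hF : ∀ l : List A.V, F (l.map i.toFun) = 0) (S : Submodule R M)
    (hS : ∀ (l : List X.V) (m : ℕ), X.IsGen n l → (m : ℤ) ≤ p → X.length l ≤ m → F l ∈ S)
    {x : RC R X n ⧸ LinearMap.range (RCmap R i n)}
    (hx : x ∈ (RCF R X p n).map (LinearMap.range (RCmap R i n)).mkQ) :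
    relLift i n F hF x ∈ S := by
  obtain ⟨y, hy, rfl⟩ := hx
  exact linearCombination_mem (fun l => F l.1) S (fun l m => hS l.1 m l.2) hy

theorem relHom_ext {i : A ⟶ X} {n : ℤ}
    {φ ψ : (RC R X n ⧸ LinearMap.range (RCmap R i n)) →ₗ[R] M}
    (h : ∀ l, X.IsGen n l → φ (relGen R i n l) = ψ (relGen R i n l)) : φ = ψ := by
  refine Submodule.linearMap_qext _ (Finsupp.lhom_ext' fun l => LinearMap.ext_ring ?_)
  have := h l.1 l.2
  rwa [relGen, gen, dif_pos l.2] at this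

theorem relD_relGen (i : A ⟶ X) (m n : ℤ) {l : List X.V} (h : l.IsChain X.Reachable)
    (hm : (l.length : ℤ) = m + 1) :
    relD R i m n (relGen R i m l) = altSum R (relGen R i n) l := by
  have e : relD R i m n (relGen R i m l) =
    Submodule.mkQ (LinearMap.range (RCmap R i n)) (RCd R X m n (gen R X m l)) := rfl
  rw [e, RCd_gen m n h hm, bdry_eq, map_altSum]
  rfl

theorem relLift_relD {i : A ⟶ X} {m n : ℤ} (hmn : m = n + 1) {F : List X.V → M}
    (hF : ∀ l : List A.V, F (l.map i.toFun) = 0) (hd : ∀ l, ¬ l.IsChain (· ≠ ·) → F l = 0)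
    {l : List X.V} (h : l.IsChain X.Reachable) (hm : (l.length : ℤ) = m + 1) :
    relLift i n F hF (relD R i m n (relGen R i m l)) = altSum R F l := by
  subst hmn
  rw [relD_relGen i _ n h hm, map_altSum]
  refine altSum_congr fun k hk => relLift_relGen hF (isChain_eraseIdx h k) ?_ (hd _)
  exact length_eraseIdx_cast (Finset.mem_range.2 hk) hm

end Relative

/-! ### Projections -/

section Projection

variable {R : Type w} [CommRing R] {A X Y P : DiGraph.{u}}

/-- The metric content of a cofibration `i : A ⟶ X`, with a choice of projections `π x`. -/
structure IsProjection (i : A ⟶ X) (π : X.V → X.V) : Prop where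
  reachable : ∀ a b, X.Reachable (i.toFun a) (i.toFun b) → A.Reachable a b
  no_return : ∀ x a, X.Reachable x (i.toFun a) → x ∈ Set.range i.toFun
  map_self : ∀ a, π (i.toFun a) = i.toFun a
  map_mem : ∀ a x, X.Reachable (i.toFun a) x → π x ∈ Set.range i.toFun
  dist_eq : ∀ a x, X.Reachable (i.toFun a) x →
    X.dist (i.toFun a) x = X.dist (i.toFun a) (π x) + X.dist (π x) x

variable {i : A ⟶ X} {π : X.V → X.V}

theorem IsProjection.relGen_eq_zero (hi : IsProjection i π) (n : ℤ) {l : List X.V}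
    (h : ∀ x ∈ l, x ∈ Set.range i.toFun) : relGen R i n l = 0 := by
  obtain ⟨l, rfl⟩ : l ∈ Set.range (List.map i.toFun) := by
    rw [Set.range_list_map]; exact h
  exact relGen_map i hi.reachable n l

theorem IsProjection.notMem_of_isChain (hi : IsProjection i π) {x : X.V} {l : List X.V}
    (h : (x :: l).IsChain X.Reachable) (hx : x ∉ Set.range i.toFun) :
    ∀ y ∈ x :: l, y ∉ Set.range i.toFun := by
  rintro y hy ⟨a, rfl⟩
  exact hx (hi.no_return x a (reachable_of_isChain h hy))

/-- The first entry is fixed by `π`, so the overhead `d(πx,x)` is zero. -/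
theorem IsProjection.length_prismFace_le (hi : IsProjection i π) {x : X.V} {l : List X.V}
    (h : (x :: l).IsChain X.Reachable) (hx : x ∈ Set.range i.toFun) {k : ℕ}
    (hk : k < (x :: l).length) :
    X.length (prismFace id π (x :: l) k) ≤ X.length (x :: l) := by
  obtain ⟨a, rfl⟩ := hx
  have := DiGraph.length_prismFace_le (ι := id) (π := π) (W := {y | X.Reachable (i.toFun a) y})
    (fun _ _ _ _ => le_rfl) ?_ (fun y hy => reachable_of_isChain h hy) hk
  · rwa [hi.map_self, id, dist_self, zero_add] at this
  · intro y hy z hz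
    obtain ⟨b, hb⟩ := hi.map_mem a y hy
    -- The projection identity is available only for reachable `z`; otherwise the bound is infinite.
    by_cases hr : X.Reachable (π y) z
    · rw [← hb] at hr ⊢
      exact (hi.dist_eq b z hr).ge
    · rw [← dist_ne_top_iff, not_not] at hr
      simp [hr]

theorem IsProjection.prismOn_map (hi : IsProjection i π) (n : ℤ) (l : List A.V) :
    prismOn R (Set.range i.toFun) π (relGen R i n) (l.map i.toFun) = 0 := by
  have e : ∀ k, prismFace id π (l.map i.toFun) k = (prismFace id id l k).map i.toFun := by
    intro k
    rw [prismFace_comp, prismFace_map]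
    exact prismFace_congr (fun _ _ => rfl) (fun x _ => hi.map_self x) k
  have : prismSum R id π (relGen R i n) (l.map i.toFun) = 0 :=
    Finset.sum_eq_zero fun k _ => by rw [e, relGen_map i hi.reachable, smul_zero]
  cases l with
  | nil => rfl
  | cons x l =>
    rw [List.map_cons, prismOn_cons_of_mem (Set.mem_range_self x)]
    exact this

/-- The contraction of `RC(X,A)` that inserts projections. -/
noncomputable def IsProjection.homotopy (R : Type w) [CommRing R] (hi : IsProjection i π)
    (m n : ℤ) :
    (RC R X m ⧸ LinearMap.range (RCmap R i m)) →ₗ[R]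
      (RC R X n ⧸ LinearMap.range (RCmap R i n)) :=
  relLift i m (prismOn R (Set.range i.toFun) π (relGen R i n)) (hi.prismOn_map n)

theorem IsProjection.homotopy_mem (hi : IsProjection i π) {p m n : ℤ}
    {x : RC R X m ⧸ LinearMap.range (RCmap R i m)}
    (hx : x ∈ (RCF R X p m).map (LinearMap.range (RCmap R i m)).mkQ) :
    hi.homotopy R m n x ∈ (RCF R X p n).map (LinearMap.range (RCmap R i n)).mkQ := by
  refine relLift_mem _ _ (fun l t hl ht hlt => ?_) hx
  cases l with
  | nil => exact zero_mem _
  | cons x l =>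
    by_cases hx : x ∈ Set.range i.toFun
    · rw [prismOn_cons_of_mem hx]
      refine Submodule.sum_mem _ fun k hk => Submodule.smul_mem _ _ ?_
      exact relGen_mem i ht
        ((hi.length_prismFace_le hl.isChain hx (Finset.mem_range.1 hk)).trans hlt)
    · rw [prismOn, if_neg hx]
      exact zero_mem _

theorem IsProjection.homotopy_eq (hi : IsProjection i π) {n : ℤ} {l : List X.V}
    (hl : X.IsGen n l) :
    relGen R i n l - collapse R (Set.range i.toFun) id π (relGen R i n) l =
      relD R i (n + 1) n (hi.homotopy R n (n + 1) (relGen R i n l)) +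
        hi.homotopy R (n - 1) n (relD R i n (n - 1) (relGen R i n l)) := by
  have hc := hl.isChain
  rw [IsProjection.homotopy, IsProjection.homotopy,
    relLift_relD (by ring) _ (fun l => prismOn_degenerate (relGen_degenerate i n)) hc hl.2.1,
    relLift_relGen _ hc hl.2.1 (prismOn_degenerate (relGen_degenerate i (n + 1))),
    sub_collapse (relGen_map i hi.reachable n [])]
  · congr 1
    cases l with
    | nil => simp [prismOn]
    | cons x l =>
      by_cases hx : x ∈ Set.range i.toFun
      · rw [prismOn_cons_of_mem hx, prismOn_cons_of_mem hx, map_prismSum]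
        refine prismSum_congr fun k hk => (relD_relGen i (n + 1) n ?_ ?_).symm
        · rw [← length_ne_top_iff]
          exact ne_top_of_le_ne_top (length_ne_top_iff.2 hc) (hi.length_prismFace_le hc hx hk)
        · have := hl.2.1
          rw [length_prismFace hk]
          push_cast
          omega
      · simp only [prismOn, if_neg hx, map_zero]
  · cases l with
    | nil => simp
    | cons x l =>
      by_cases hx : x ∈ Set.range i.toFun
      · exact Or.inl ⟨x, rfl, hx⟩
      · exact Or.inr (hi.notMem_of_isChain hc hx)
  -- All entries are reachable from the first, which lies in `A`, so `π` sends the whole tuple into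
  -- `A`.
  · rintro ⟨x, hx, a, rfl⟩
    cases l with
    | nil => simp at hx
    | cons x l =>
      obtain rfl : x = i.toFun a := by simpa using hx
      refine hi.relGen_eq_zero n fun y hy => ?_
      obtain ⟨z, hz, rfl⟩ := List.mem_map.1 hy
      exact hi.map_mem a z (reachable_of_isChain hc hz)

/-! ### The backward chain map -/

/-- The metric conditions on `ι, π : P ⟶ X` under which `collapse` is a filtered chain map
`RC(P,Y) ⟶ RC(X,A)`. -/
structure IsCollapse (i : A ⟶ X) (j : Y ⟶ P) (ι π : P.V → X.V) : Prop where
  dist_map_le : ∀ x ∉ Set.range j.toFun, ∀ y ∉ Set.range j.toFun,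
    X.dist (ι x) (ι y) ≤ P.dist x y
  map_mem : ∀ y, ∀ x ∉ Set.range j.toFun, P.Reachable (j.toFun y) x → π x ∈ Set.range i.toFun
  dist_le : ∀ y, ∀ x ∉ Set.range j.toFun, P.Reachable (j.toFun y) x →
    X.dist (π x) (ι x) ≤ P.dist (j.toFun y) x
  dist_eq : ∀ a y, ∀ x ∉ Set.range j.toFun, P.Reachable (j.toFun y) x →
    X.dist (i.toFun a) (π x) + X.dist (π x) (ι x) ≤ X.dist (i.toFun a) (ι x)

variable {j : Y ⟶ P} {ι ϖ : P.V → X.V} {σ : P.V → P.V}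

/-- The overhead `d(ϖy,ιy)` is at most `d(x,y)`, the length of the step out of `Y` that is lost when
`x` is forgotten. -/
theorem IsCollapse.length_prismFace_le (h : IsCollapse i j ι ϖ) (hj : IsProjection j σ)
    {x y : P.V} {l : List P.V} (hc : (x :: y :: l).IsChain P.Reachable)
    (hx : x ∈ Set.range j.toFun) (hy : y ∉ Set.range j.toFun) {k : ℕ}
    (hk : k < (y :: l).length) :
    X.length (prismFace ι ϖ (y :: l) k) ≤ P.length (x :: y :: l) := by
  obtain ⟨a, rfl⟩ := hx
  have hr : ∀ z ∈ y :: l, P.Reachable (j.toFun a) z := fun z hz =>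
    reachable_of_isChain hc (List.mem_cons_of_mem _ hz)
  have := DiGraph.length_prismFace_le (ι := ι) (π := ϖ)
    (W := {z | z ∉ Set.range j.toFun ∧ P.Reachable (j.toFun a) z})
    (fun s hs t ht => h.dist_map_le s hs.1 t ht.1) ?_
    (fun z hz => ⟨hj.notMem_of_isChain hc.tail hy z hz, hr z hz⟩) hk
  · refine this.trans ?_
    rw [length]
    gcongr
    exact h.dist_le a y hy (hr y (by simp))
  · intro s hs t ht
    obtain ⟨b, hb⟩ := h.map_mem a s hs.1 hs.2
    rw [← hb]
    exact h.dist_eq b a t ht.1 ht.2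

theorem collapse_map {M : Type*} [AddCommGroup M] [Module R M] (ι π : P.V → X.V)
    (g : List X.V → M) (l : List Y.V) :
    collapse R (Set.range j.toFun) ι π g (l.map j.toFun) = 0 := by
  cases l with
  | nil => rfl
  | cons x l => cases l <;> simp [collapse, prismOff]

/-- The linear map `RC(P,Y) ⟶ RC(X,A)` defined by `collapse`. -/
noncomputable def relCollapse (R : Type w) [CommRing R] (i : A ⟶ X) (j : Y ⟶ P)
    (ι π : P.V → X.V) (n : ℤ) :
    (RC R P n ⧸ LinearMap.range (RCmap R j n)) →ₗ[R]
      (RC R X n ⧸ LinearMap.range (RCmap R i n)) :=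
  relLift j n (collapse R (Set.range j.toFun) ι π (relGen R i n)) (collapse_map ι π _)

theorem relCollapse_relGen {n : ℤ} {l : List P.V} (hc : l.IsChain P.Reachable)
    (hl : (l.length : ℤ) = n + 1) :
    relCollapse R i j ι ϖ n (relGen R j n l) =
      collapse R (Set.range j.toFun) ι ϖ (relGen R i n) l :=
  relLift_relGen _ hc hl (collapse_degenerate (relGen_degenerate i n))

theorem IsCollapse.relCollapse_mem (h : IsCollapse i j ι ϖ) (hj : IsProjection j σ) {p n : ℤ}
    {x : RC R P n ⧸ LinearMap.range (RCmap R j n)}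
    (hx : x ∈ (RCF R P p n).map (LinearMap.range (RCmap R j n)).mkQ) :
    relCollapse R i j ι ϖ n x ∈ (RCF R X p n).map (LinearMap.range (RCmap R i n)).mkQ := by
  refine relLift_mem _ _ (fun l t hl ht hlt => ?_) hx
  cases l with
  | nil => exact zero_mem _
  | cons x l =>
    by_cases hx : x ∈ Set.range j.toFun
    · rw [collapse, if_pos hx]
      cases l with
      | nil => exact zero_mem _
      | cons y l =>
        by_cases hy : y ∈ Set.range j.toFun
        · rw [prismOff, if_pos hy]
          exact zero_mem _
        · rw [prismOff, if_neg hy]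
          refine Submodule.sum_mem _ fun k hk => Submodule.smul_mem _ _ ?_
          exact relGen_mem i ht
            ((h.length_prismFace_le hj hl.isChain hx hy (Finset.mem_range.1 hk)).trans hlt)
    · rw [collapse, if_neg hx]
      refine relGen_mem i ht (le_trans ?_ hlt)
      exact length_map_le_of (W := (Set.range j.toFun)ᶜ) h.dist_map_le
        (hj.notMem_of_isChain hl.isChain hx)

theorem IsCollapse.relCollapse_relD (h : IsCollapse i j ι ϖ) (hi : IsProjection i π)
    (hj : IsProjection j σ) {m n : ℤ} (hmn : m = n + 1)
    (x : RC R P m ⧸ LinearMap.range (RCmap R j m)) :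
    relD R i m n (relCollapse R i j ι ϖ m x) = relCollapse R i j ι ϖ n (relD R j m n x) := by
  suffices H : relD R i m n ∘ₗ relCollapse R i j ι ϖ m =
      relCollapse R i j ι ϖ n ∘ₗ relD R j m n from LinearMap.congr_fun H x
  refine relHom_ext fun l hl => ?_
  have hc := hl.isChain
  have hm := hl.2.1
  rw [LinearMap.comp_apply, LinearMap.comp_apply, relCollapse_relGen hc hm,
    relCollapse, relLift_relD hmn _ (fun l => collapse_degenerate (relGen_degenerate i n)) hc hm,
    ← collapse_altSum (relGen_map i hi.reachable n [])]
  · cases l with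
    | nil => simp [collapse]
    | cons x l =>
      by_cases hx : x ∈ Set.range j.toFun
      · rw [collapse, if_pos hx, collapse, if_pos hx]
        cases l with
        | nil => simp [prismOff]
        | cons y l =>
          by_cases hy : y ∈ Set.range j.toFun
          · simp only [prismOff, if_pos hy, map_zero]
          · rw [prismOff, if_neg hy, prismOff, if_neg hy, map_prismSum]
            refine prismSum_congr fun k hk => relD_relGen i m n ?_ ?_
            · rw [← length_ne_top_iff]
              exact ne_top_of_le_ne_top (length_ne_top_iff.2 hc)
                (h.length_prismFace_le hj hc hx hy hk)
            · rw [length_prismFace hk]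
              exact hm
      · rw [collapse, if_neg hx, collapse, if_neg hx]
        refine relD_relGen i m n ?_ (by simpa using hm)
        rw [← length_ne_top_iff]
        exact ne_top_of_le_ne_top (length_ne_top_iff.2 hc) (length_map_le_of (W :=
          (Set.range j.toFun)ᶜ) h.dist_map_le (hj.notMem_of_isChain hc hx))
  · rintro x l' rfl hx y hy
    exact hj.notMem_of_isChain hc hx y (List.mem_cons_of_mem _ hy)
  -- Once outside `Y` the tuple stays outside, and its entries, being reachable from `Y`, have
  -- projections in `A`; so the `π` term vanishes modulo `A`.
  · rintro x y l' rfl ⟨a, rfl⟩ hy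
    have hn := hj.notMem_of_isChain hc.tail hy
    refine ⟨fun z hz => hn z (List.mem_cons_of_mem _ hz), hi.relGen_eq_zero n fun z hz => ?_⟩
    obtain ⟨t, ht, rfl⟩ := List.mem_map.1 hz
    exact h.map_mem a t (hn t ht) (reachable_of_isChain hc (List.mem_cons_of_mem _ ht))

/-- The filtered chain map `RC(P,Y) ⟶ RC(X,A)` defined by `collapse`. -/
noncomputable def IsCollapse.hom (R : Type w) [CommRing R] (h : IsCollapse i j ι ϖ)
    (hi : IsProjection i π) (hj : IsProjection j σ) : (relRC R j).Hom (relRC R i) where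
  φ :=
    { f := fun n => ModuleCat.ofHom (relCollapse R i j ι ϖ n)
      comm' := fun m n hmn => by
        ext1
        exact LinearMap.ext fun x => h.relCollapse_relD hi hj (Eq.symm hmn) x }
  map_mem := fun _ _ _ hx => h.relCollapse_mem hj hx

end Projection

end DiGraph

namespace DiGraph

/-! ### Excision for squares with compatible projections -/

section Excision

variable {R : Type w} [CommRing R] {A X Y P : DiGraph.{u}}
  {i : A ⟶ X} {f : A ⟶ Y} {g : X ⟶ P} {j : Y ⟶ P}

/-- The map `g` identifies the complement of `A` in `X` with the complement of `Y` in `P`,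
with inverse `ι`, compatibly with the projections `π` and `σ`. -/
structure IsExcisive (i : A ⟶ X) (g : X ⟶ P) (j : Y ⟶ P) (ι : P.V → X.V) (π : X.V → X.V)
    (σ : P.V → P.V) : Prop where
  map_mem : ∀ x ∈ Set.range i.toFun, g.toFun x ∈ Set.range j.toFun
  map_notMem : ∀ x ∉ Set.range i.toFun, g.toFun x ∉ Set.range j.toFun
  left_inv : ∀ x ∉ Set.range i.toFun, ι (g.toFun x) = x
  right_inv : ∀ p ∉ Set.range j.toFun, g.toFun (ι p) = p
  map_proj : ∀ p ∉ Set.range j.toFun, σ p = g.toFun (π (ι p))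

variable {ι : P.V → X.V} {π : X.V → X.V} {σ : P.V → P.V}

variable (R) in
/-- The components of the chain map `RC(X,A) ⟶ RC(P,Y)` induced by a commutative square. -/
noncomputable def relMap (sq : i ≫ g = f ≫ j) (n : ℤ) :
    (RC R X n ⧸ LinearMap.range (RCmap R i n)) →ₗ[R]
      (RC R P n ⧸ LinearMap.range (RCmap R j n)) :=
  ((relRCmap R sq).φ.f n).hom

theorem relMap_relGen (sq : i ≫ g = f ≫ j) {n : ℤ} {l : List X.V}
    (hc : l.IsChain X.Reachable) (hl : (l.length : ℤ) = n + 1) :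
    relMap R sq n (relGen R i n l) = relGen R j n (l.map g.toFun) := by
  have := congrArg (Submodule.mkQ (LinearMap.range (RCmap R j n))) (RCmap_gen (R := R) g n hc hl)
  exact this

/-- Since `collapse` uses only the entries outside `A`, where `ι` inverts `g`, going to `P` and back
is the operator `collapse` of `X`. -/
theorem IsExcisive.collapse_map (h : IsExcisive i g j ι π σ) (hi : IsProjection i π) {n : ℤ}
    {l : List X.V} (hc : l.IsChain X.Reachable) :
    collapse R (Set.range j.toFun) ι (π ∘ ι) (relGen R i n) (l.map g.toFun) =
      collapse R (Set.range i.toFun) id π (relGen R i n) l := by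
  cases l with
  | nil => rfl
  | cons x l =>
    by_cases hx : x ∈ Set.range i.toFun
    · rw [List.map_cons, collapse, if_pos (h.map_mem x hx), collapse, if_pos hx]
      cases l with
      | nil => rfl
      | cons y l =>
        by_cases hy : y ∈ Set.range i.toFun
        · rw [List.map_cons, prismOff, if_pos (h.map_mem y hy), prismOff, if_pos hy]
        · have hn := hi.notMem_of_isChain hc.tail hy
          have hn' : ∀ p ∈ (y :: l).map g.toFun, p ∉ Set.range j.toFun :=
            List.forall_mem_map.2 fun z hz => h.map_notMem z (hn z hz)
          rw [prismOff_eq hn', prismOff_eq hn, prismSum, prismSum, List.length_map]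
          refine Finset.sum_congr rfl fun k _ => ?_
          rw [prismFace_comp, prismFace_congr (ι := ι ∘ g.toFun)
            (π := (π ∘ ι) ∘ g.toFun) (ι' := id) (π' := π)
            (fun z hz => h.left_inv z (hn z hz))
            (fun z hz => congrArg π (h.left_inv z (hn z hz)))]
    · have hn := hi.notMem_of_isChain hc hx
      rw [List.map_cons, collapse, if_neg (h.map_notMem x hx), collapse, if_neg hx,
        ← List.map_cons, ← List.map_cons, ← List.map_cons, List.map_map, List.map_id]
      congr 1
      exact (List.map_congr_left fun z hz => h.left_inv z (hn z hz)).trans (List.map_id _)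

/-- The other composite: `g` carries the prism for `ι` and `π ∘ ι` to the prism for the identity and
`σ`, by `right_inv` and `map_proj`. -/
theorem IsExcisive.map_collapse (h : IsExcisive i g j ι π σ) (sq : i ≫ g = f ≫ j)
    (hj : IsProjection j σ) (hk : IsCollapse i j ι (π ∘ ι)) {n : ℤ}
    {l : List P.V} (hl : P.IsGen n l) :
    relMap R sq n (collapse R (Set.range j.toFun) ι (π ∘ ι) (relGen R i n) l) =
      collapse R (Set.range j.toFun) id σ (relGen R j n) l := by
  have hc := hl.isChain
  cases l with
  | nil => exact map_zero _
  | cons x l =>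
    by_cases hx : x ∈ Set.range j.toFun
    · rw [collapse, if_pos hx, collapse, if_pos hx]
      cases l with
      | nil => exact map_zero _
      | cons y l =>
        by_cases hy : y ∈ Set.range j.toFun
        · rw [prismOff, if_pos hy, prismOff, if_pos hy]
          exact map_zero _
        · have hn := hj.notMem_of_isChain hc.tail hy
          rw [prismOff_eq hn, prismOff_eq hn]
          rw [map_prismSum]
          refine Finset.sum_congr rfl fun k hk' => ?_
          rw [Finset.mem_range] at hk'
          beta_reduce
          rw [relMap_relGen]
          · rw [prismFace_map, prismFace_congr (ι := g.toFun ∘ ι)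
              (π := g.toFun ∘ π ∘ ι) (ι' := id) (π' := σ)
              (fun z hz => h.right_inv z (hn z hz))
              (fun z hz => (h.map_proj z (hn z hz)).symm)]
          · rw [← length_ne_top_iff]
            exact ne_top_of_le_ne_top (length_ne_top_iff.2 hc)
              (hk.length_prismFace_le hj hc hx hy hk')
          · rw [length_prismFace hk']
            exact hl.2.1
    · have hn := hj.notMem_of_isChain hc hx
      rw [collapse, if_neg hx, collapse, if_neg hx, ← List.map_cons, ← List.map_cons,
        relMap_relGen, List.map_map, List.map_id]
      · congr 1
        exact (List.map_congr_left fun z hz => h.right_inv z (hn z hz)).trans (List.map_id _)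
      · rw [← length_ne_top_iff]
        exact ne_top_of_le_ne_top (length_ne_top_iff.2 hc) (length_map_le_of (W :=
          (Set.range j.toFun)ᶜ) hk.dist_map_le hn)
      · simpa using hl.2.1

theorem IsExcisive.bijective (h : IsExcisive i g j ι π σ) (sq : i ≫ g = f ≫ j)
    (hi : IsProjection i π) (hj : IsProjection j σ) (hk : IsCollapse i j ι (π ∘ ι)) {r : ℕ}
    (hr : 1 ≤ r) (p q : ℤ) : Function.Bijective (relEmap R sq r p q) := by
  refine FilteredComplex.Hom.mapE_bijective (h := relRCmap R sq) (k := hk.hom R hi hj)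
    (s := hi.homotopy R) (t := hj.homotopy R)
    ⟨fun hx => hi.homotopy_mem hx, fun n => ?_⟩ ⟨fun hx => hj.homotopy_mem hx, fun n => ?_⟩ hr p q
  · have H : LinearMap.id - (relCollapse R i j ι (π ∘ ι) n) ∘ₗ relMap R sq n =
        relD R i (n + 1) n ∘ₗ hi.homotopy R n (n + 1) +
          hi.homotopy R (n - 1) n ∘ₗ relD R i n (n - 1) := by
      refine relHom_ext fun l hl => ?_
      have hc := hl.isChain
      refine Eq.trans ?_ (hi.homotopy_eq hl)
      rw [LinearMap.sub_apply, LinearMap.comp_apply, relMap_relGen sq hc hl.2.1,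
        relCollapse_relGen _ (by simpa using hl.2.1), h.collapse_map hi hc]
      · rfl
      · exact List.isChain_map_of_isChain g.toFun (fun _ _ h => Reachable.map g h) hc
    exact fun x => LinearMap.congr_fun H x
  · have H : LinearMap.id - relMap R sq n ∘ₗ (relCollapse R i j ι (π ∘ ι) n) =
        relD R j (n + 1) n ∘ₗ hj.homotopy R n (n + 1) +
          hj.homotopy R (n - 1) n ∘ₗ relD R j n (n - 1) := by
      refine relHom_ext fun l hl => ?_
      refine Eq.trans ?_ (hj.homotopy_eq hl)
      rw [LinearMap.sub_apply, LinearMap.comp_apply, relCollapse_relGen hl.isChain hl.2.1,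
        h.map_collapse sq hj hk hl]
      rfl
    exact fun x => LinearMap.congr_fun H x

end Excision

/-! ### The pushout along a cofibration -/

section Pushout

variable {A X Y P : DiGraph.{u}} {i : A ⟶ X} {f : A ⟶ Y} {g : X ⟶ P} {j : Y ⟶ P}

theorem IsCofibration.mem_range_of_hasPath (hi : IsCofibration i) {n : ℕ} {x : X.V} {a : A.V}
    (h : X.HasPath n x (i.toFun a)) : x ∈ Set.range i.toFun := by
  induction n generalizing x with
  | zero => exact ⟨a, h.symm⟩
  | succ n ih =>
    obtain ⟨z, hz, h⟩ := h
    obtain ⟨b, rfl⟩ := ih h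
    by_contra hx
    exact hi.no_entry x b hx hz

/-- A path that ends in `A` never lies outside `A`, and its edges belong to `A` because the subgraph
is induced. -/
theorem IsCofibration.hasPath (hi : IsCofibration i) {n : ℕ} {a b : A.V}
    (h : X.HasPath n (i.toFun a) (i.toFun b)) : A.HasPath n a b := by
  induction n generalizing a with
  | zero => exact hi.injective h
  | succ n ih =>
    obtain ⟨z, hz, h⟩ := h
    obtain ⟨c, rfl⟩ := hi.mem_range_of_hasPath h
    exact ⟨c, (hi.induced a c).1 hz, ih h⟩

theorem IsCofibration.dist_le (hi : IsCofibration i) (a b : A.V) :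
    A.dist a b ≤ X.dist (i.toFun a) (i.toFun b) :=
  le_iInf₂ fun _ hn => DiGraph.dist_le (hi.hasPath hn)

theorem IsCofibration.exists_isProjection (hi : IsCofibration i) :
    ∃ π : X.V → X.V, IsProjection i π := by
  -- The projection is set to `x` on `A`, and also, as a default value, at vertices not reachable
  -- from `A`.
  have H : ∀ x, ∃ y, (x ∈ Set.range i.toFun → y = x) ∧ ∀ a, X.Reachable (i.toFun a) x →
      y ∈ Set.range i.toFun ∧
        X.dist (i.toFun a) x = X.dist (i.toFun a) y + X.dist y x := by
    intro x
    by_cases hx : x ∈ Set.range i.toFun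
    · exact ⟨x, fun _ => rfl, fun a _ => ⟨hx, by simp [dist_self]⟩⟩
    · by_cases hr : ∃ a, X.Reachable (i.toFun a) x
      · obtain ⟨b, hb⟩ := hi.projects x hr
        exact ⟨i.toFun b, fun h => (hx h).elim, fun a _ => ⟨⟨b, rfl⟩, hb a⟩⟩
      · exact ⟨x, fun _ => rfl, fun a ha => (hr ⟨a, ha⟩).elim⟩
  choose π h1 h2 using H
  exact ⟨π, fun a b ⟨n, h⟩ => ⟨n, hi.hasPath h⟩, fun x a ⟨n, h⟩ => hi.mem_range_of_hasPath h,
    fun a => h1 _ ⟨a, rfl⟩, fun a x h => (h2 x a h).1, fun a x h => (h2 x a h).2⟩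

/-! ### The standard model of the pushout -/

/-- The edges of the standard pushout: those of `Y`, those of `X` outside `A`, and
an edge from `f a` to `x` for each edge of `X` from `a` to a vertex `x` outside `A`. -/
def gluedAdj (i : A ⟶ X) (f : A ⟶ Y) :
    Y.V ⊕ {x : X.V // x ∉ Set.range i.toFun} → Y.V ⊕ {x : X.V // x ∉ Set.range i.toFun} → Prop
  | .inl y, .inl y' => Y.Adj y y'
  | .inl y, .inr x => ∃ a, f.toFun a = y ∧ X.Adj (i.toFun a) x.1
  | .inr _, .inl _ => False
  | .inr x, .inr x' => X.Adj x.1 x'.1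

/-- The standard model of the pushout of `i` and `f`. -/
def glued (i : A ⟶ X) (f : A ⟶ Y) : DiGraph.{u} where
  V := Y.V ⊕ {x : X.V // x ∉ Set.range i.toFun}
  graph := ⟨gluedAdj i f⟩

/-- The map from `Y` to the standard model of the pushout. -/
def gluedInl (i : A ⟶ X) (f : A ⟶ Y) : Y ⟶ glued i f := ⟨Sum.inl, fun _ _ h => Or.inr h⟩

open Classical in
/-- The vertex map from `X` to the standard model of the pushout. -/
noncomputable def gluedInrFun (i : A ⟶ X) (f : A ⟶ Y) (x : X.V) :
    Y.V ⊕ {x : X.V // x ∉ Set.range i.toFun} :=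
  if h : x ∈ Set.range i.toFun then Sum.inl (f.toFun (Set.mem_range.1 h).choose) else Sum.inr ⟨x, h⟩

theorem gluedInrFun_apply (hi : IsCofibration i) (a : A.V) :
    gluedInrFun i f (i.toFun a) = Sum.inl (f.toFun a) := by
  have h : i.toFun a ∈ Set.range i.toFun := ⟨a, rfl⟩
  rw [gluedInrFun, dif_pos h, hi.injective (Set.mem_range.1 h).choose_spec]

theorem gluedInrFun_of_notMem {x : X.V} (h : x ∉ Set.range i.toFun) :
    gluedInrFun i f x = Sum.inr ⟨x, h⟩ := dif_neg h

/-- The map from `X` to the standard model of the pushout. -/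
noncomputable def gluedInr (hi : IsCofibration i) (f : A ⟶ Y) : X ⟶ glued i f :=
  ⟨gluedInrFun i f, fun x y h => by
    by_cases hy : y ∈ Set.range i.toFun
    · obtain ⟨b, rfl⟩ := hy
      by_cases hx : x ∈ Set.range i.toFun
      · obtain ⟨a, rfl⟩ := hx
        rw [gluedInrFun_apply hi, gluedInrFun_apply hi]
        rcases f.map_adj a b ((hi.induced a b).1 h) with e | e
        · exact Or.inl (congrArg _ e)
        · exact Or.inr e
      · exact (hi.no_entry x b hx h).elim
    · rw [gluedInrFun_of_notMem hy]
      by_cases hx : x ∈ Set.range i.toFun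
      · obtain ⟨a, rfl⟩ := hx
        rw [gluedInrFun_apply hi]
        exact Or.inr ⟨a, rfl, h⟩
      · rw [gluedInrFun_of_notMem hx]
        exact Or.inr h⟩

theorem gluedInr_comm (hi : IsCofibration i) (f : A ⟶ Y) :
    i ≫ gluedInr hi f = f ≫ gluedInl i f :=
  Hom.ext (funext fun a => gluedInrFun_apply hi a)

/-- The map from the standard model of the pushout induced by a commutative square. -/
def gluedDesc (sq : i ≫ g = f ≫ j) : glued i f ⟶ P :=
  ⟨Sum.elim j.toFun fun x => g.toFun x.1, by
    rintro (y | x) (y' | x') h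
    · exact j.map_adj _ _ h
    · obtain ⟨a, rfl, h⟩ := h
      have e : g.toFun (i.toFun a) = j.toFun (f.toFun a) := congrFun (congrArg Hom.toFun sq) a
      have := g.map_adj _ _ h
      rw [e] at this
      exact this
    · exact h.elim
    · exact g.map_adj _ _ h⟩

theorem glued_hasPath_inr {n : ℕ} {x : {x : X.V // x ∉ Set.range i.toFun}} {q : (glued i f).V}
    (h : (glued i f).HasPath n (Sum.inr x) q) :
    ∃ x', q = Sum.inr x' ∧ X.HasPath n x.1 x'.1 := by
  induction n generalizing x with
  | zero => exact ⟨x, h.symm, rfl⟩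
  | succ n ih =>
    obtain ⟨z | z, hz, h⟩ := h
    · exact hz.elim
    · obtain ⟨x', e, h'⟩ := ih h
      exact ⟨x', e, z.1, hz, h'⟩

theorem glued_hasPath_inl {n : ℕ} {y y' : Y.V}
    (h : (glued i f).HasPath n (Sum.inl y) (Sum.inl y')) : Y.HasPath n y y' := by
  induction n generalizing y with
  | zero => exact Sum.inl.inj h
  | succ n ih =>
    obtain ⟨z | z, hz, h⟩ := h
    · exact ⟨z, hz, ih h⟩
    · obtain ⟨x', e, -⟩ := glued_hasPath_inr h
      simp at e

/-- The path crosses from `Y` to the complement of `A` exactly once, and the crossing edge comes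
from an edge of `X` starting at some `a` in `A`. -/
theorem glued_hasPath_inl_inr {n : ℕ} {y : Y.V} {x : {x : X.V // x ∉ Set.range i.toFun}}
    (h : (glued i f).HasPath n (Sum.inl y) (Sum.inr x)) :
    ∃ a m k, m + k = n ∧ Y.HasPath m y (f.toFun a) ∧ X.HasPath k (i.toFun a) x.1 := by
  induction n generalizing y with
  | zero => exact (Sum.inl_ne_inr h).elim
  | succ n ih =>
    obtain ⟨z | z, hz, h⟩ := h
    · obtain ⟨a, m, k, e, h1, h2⟩ := ih h
      exact ⟨a, m + 1, k, by omega, ⟨z, hz, h1⟩, h2⟩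
    · obtain ⟨x', e, h'⟩ := glued_hasPath_inr h
      obtain rfl := Sum.inr.inj e
      obtain ⟨a, rfl, ha⟩ := hz
      exact ⟨a, 0, n + 1, by omega, rfl, z.1, ha, h'⟩

/-! ### Distances in an arbitrary pushout -/

/-- The comparison of a pushout with the standard model. -/
noncomputable def toGlued (hi : IsCofibration i) (hP : IsPushout i f g j) : P ⟶ glued i f :=
  hP.desc (gluedInr hi f) (gluedInl i f) (gluedInr_comm hi f)

theorem toGlued_inl (hi : IsCofibration i) (hP : IsPushout i f g j)
    (y : Y.V) : (toGlued hi hP).toFun (j.toFun y) = Sum.inl y :=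
  congrFun (congrArg Hom.toFun (hP.inr_desc _ _ (gluedInr_comm hi f))) y

theorem toGlued_inr (hi : IsCofibration i) (hP : IsPushout i f g j)
    {x : X.V} (hx : x ∉ Set.range i.toFun) :
    (toGlued hi hP).toFun (g.toFun x) = Sum.inr ⟨x, hx⟩ :=
  (congrFun (congrArg Hom.toFun (hP.inl_desc _ _ (gluedInr_comm hi f))) x).trans
    (gluedInrFun_of_notMem hx)

/-- This one composite suffices: it shows that every vertex of `P` comes from `Y` or from outside
`A`. Lower bounds on distances use only that `toGlued` is a map, which may shorten paths but not
lengthen them. -/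
theorem gluedDesc_toGlued (hi : IsCofibration i) (hP : IsPushout i f g j)
    (p : P.V) :
    (gluedDesc hP.w).toFun ((toGlued hi hP).toFun p) = p := by
  have : toGlued hi hP ≫ gluedDesc hP.w = 𝟙 P := by
    refine hP.hom_ext ?_ ?_
    · refine Hom.ext (funext fun x => ?_)
      change (gluedDesc hP.w).toFun ((toGlued hi hP).toFun (g.toFun x)) = g.toFun x
      by_cases hx : x ∈ Set.range i.toFun
      · obtain ⟨a, rfl⟩ := hx
        have e : g.toFun (i.toFun a) = j.toFun (f.toFun a) :=
          congrFun (congrArg Hom.toFun hP.w) a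
        rw [e, toGlued_inl]
        rfl
      · rw [toGlued_inr hi hP hx]
        rfl
    · refine Hom.ext (funext fun y => ?_)
      change (gluedDesc hP.w).toFun ((toGlued hi hP).toFun (j.toFun y)) = j.toFun y
      rw [toGlued_inl]
      rfl
  exact congrFun (congrArg Hom.toFun this) p

theorem exists_of_notMem_range (hi : IsCofibration i) (hP : IsPushout i f g j)
    {p : P.V} (hp : p ∉ Set.range j.toFun) :
    ∃ x ∉ Set.range i.toFun, g.toFun x = p := by
  have h := gluedDesc_toGlued hi hP p
  rcases e : (toGlued hi hP).toFun p with y | x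
  · rw [e] at h
    exact (hp ⟨y, h⟩).elim
  · rw [e] at h
    exact ⟨x.1, x.2, h⟩

theorem map_notMem_range (hi : IsCofibration i) (hP : IsPushout i f g j)
    {x : X.V} (hx : x ∉ Set.range i.toFun) :
    g.toFun x ∉ Set.range j.toFun := by
  rintro ⟨y, hy⟩
  have := toGlued_inr hi hP hx
  rw [← hy, toGlued_inl] at this
  exact Sum.inl_ne_inr this

theorem map_injOn_compl_range (hi : IsCofibration i) (hP : IsPushout i f g j)
    {x x' : X.V} (hx : x ∉ Set.range i.toFun)
    (hx' : x' ∉ Set.range i.toFun) (h : g.toFun x = g.toFun x') : x = x' := by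
  have e := toGlued_inr hi hP hx
  rw [h, toGlued_inr hi hP hx'] at e
  exact (congrArg Subtype.val (Sum.inr.inj e)).symm

theorem hasPath_of_pushout_inl (hi : IsCofibration i) (hP : IsPushout i f g j)
    {n : ℕ} {y y' : Y.V} (h : P.HasPath n (j.toFun y) (j.toFun y')) :
    ∃ m ≤ n, Y.HasPath m y y' := by
  obtain ⟨m, hm, h⟩ := h.map (toGlued hi hP)
  rw [toGlued_inl, toGlued_inl] at h
  exact ⟨m, hm, glued_hasPath_inl h⟩

theorem mem_range_of_pushout_hasPath (hi : IsCofibration i) (hP : IsPushout i f g j)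
    {n : ℕ} {p : P.V} {y : Y.V}
    (h : P.HasPath n p (j.toFun y)) : p ∈ Set.range j.toFun := by
  by_contra hp
  obtain ⟨x, hx, rfl⟩ := exists_of_notMem_range hi hP hp
  obtain ⟨m, -, h⟩ := h.map (toGlued hi hP)
  rw [toGlued_inl, toGlued_inr hi hP hx] at h
  obtain ⟨x', e, -⟩ := glued_hasPath_inr h
  exact Sum.inl_ne_inr e

theorem dist_le_pushout_inr (hi : IsCofibration i) (hP : IsPushout i f g j)
    {x x' : X.V} (hx : x ∉ Set.range i.toFun)
    (hx' : x' ∉ Set.range i.toFun) : X.dist x x' ≤ P.dist (g.toFun x) (g.toFun x') := by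
  refine le_iInf₂ fun n hn => ?_
  obtain ⟨m, hm, h⟩ := hn.map (toGlued hi hP)
  rw [toGlued_inr hi hP hx, toGlued_inr hi hP hx'] at h
  obtain ⟨z, e, h⟩ := glued_hasPath_inr h
  obtain rfl := Sum.inr.inj e
  exact (dist_le h).trans (by exact_mod_cast hm)

theorem exists_reachable_of_pushout (hi : IsCofibration i) (hP : IsPushout i f g j)
    {x : X.V} {y : Y.V} (hx : x ∉ Set.range i.toFun)
    (h : P.Reachable (j.toFun y) (g.toFun x)) : ∃ a, X.Reachable (i.toFun a) x := by
  obtain ⟨n, h⟩ := h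
  obtain ⟨m, -, h⟩ := h.map (toGlued hi hP)
  rw [toGlued_inl, toGlued_inr hi hP hx] at h
  obtain ⟨a, m, k, -, -, h⟩ := glued_hasPath_inl_inr h
  exact ⟨a, k, h⟩

/-- Wherever a path leaves `Y`, at `f a` say, it can be rerouted through `f b` at no cost: `d(a,x)`
splits at `b`, and `f` does not increase `d(a,b)`. -/
theorem dist_add_dist_le_pushout (hi : IsCofibration i) (hP : IsPushout i f g j)
    {x : X.V} (hx : x ∉ Set.range i.toFun) {b : A.V}
    (hb : ∀ a, X.Reachable (i.toFun a) x → X.dist (i.toFun a) x =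
      X.dist (i.toFun a) (i.toFun b) + X.dist (i.toFun b) x) (y : Y.V) :
    Y.dist y (f.toFun b) + X.dist (i.toFun b) x ≤ P.dist (j.toFun y) (g.toFun x) := by
  refine le_iInf₂ fun n hn => ?_
  obtain ⟨m, hm, h⟩ := hn.map (toGlued hi hP)
  rw [toGlued_inl, toGlued_inr hi hP hx] at h
  obtain ⟨a, s, t, hst, hs, ht⟩ := glued_hasPath_inl_inr h
  calc Y.dist y (f.toFun b) + X.dist (i.toFun b) x
      ≤ Y.dist y (f.toFun a) + Y.dist (f.toFun a) (f.toFun b) + X.dist (i.toFun b) x := by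
        gcongr; exact dist_triangle _ _ _
    _ ≤ Y.dist y (f.toFun a) + (X.dist (i.toFun a) (i.toFun b) + X.dist (i.toFun b) x) := by
        rw [add_assoc]
        gcongr
        exact (dist_map_le f a b).trans (hi.dist_le a b)
    _ ≤ s + t := by
        rw [← hb a ⟨t, ht⟩]
        exact add_le_add (dist_le hs) (dist_le ht)
    _ ≤ n := by exact_mod_cast hst.trans_le hm

theorem exists_isExcisive (hi : IsCofibration i) (hP : IsPushout i f g j)
    [Nonempty X.V] {π : X.V → X.V} (hπ : IsProjection i π) :
    ∃ (ι : P.V → X.V) (σ : P.V → P.V), IsExcisive i g j ι π σ ∧ IsProjection j σ ∧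
      IsCollapse i j ι (π ∘ ι) := by
  have H : ∀ p, ∃ x, p ∉ Set.range j.toFun → x ∉ Set.range i.toFun ∧ g.toFun x = p := by
    intro p
    by_cases hp : p ∈ Set.range j.toFun
    -- An irrelevant value on the image of `Y`; it is the reason for assuming that `X` is nonempty.
    · exact ⟨Classical.arbitrary _, fun h => (h hp).elim⟩
    · obtain ⟨x, hx⟩ := exists_of_notMem_range hi hP hp
      exact ⟨x, fun _ => hx⟩
  choose ι hι using H
  have hw : ∀ a, g.toFun (i.toFun a) = j.toFun (f.toFun a) :=
    congrFun (congrArg Hom.toFun hP.w)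
  classical
  let σ : P.V → P.V := fun p => if p ∈ Set.range j.toFun then p else g.toFun (π (ι p))
  have hσ : ∀ p ∉ Set.range j.toFun, σ p = g.toFun (π (ι p)) := fun p hp => if_neg hp
  have hσ' : ∀ p ∈ Set.range j.toFun, σ p = p := fun p hp => if_pos hp
  -- The vertex `b` serves all `y'` at once, as a projection to `Y` must.
  have key : ∀ p ∉ Set.range j.toFun, ∀ y, P.Reachable (j.toFun y) p →
      ∃ b, π (ι p) = i.toFun b ∧ ∀ y',
        Y.dist y' (f.toFun b) + X.dist (i.toFun b) (ι p) ≤ P.dist (j.toFun y') p := by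
    intro p hp y h
    obtain ⟨hx, e⟩ := hι p hp
    rw [← e] at h
    obtain ⟨a, ha⟩ := exists_reachable_of_pushout hi hP hx h
    obtain ⟨b, hb⟩ := hπ.map_mem a _ ha
    refine ⟨b, hb.symm, fun y' => ?_⟩
    have := dist_add_dist_le_pushout hi hP hx (b := b)
      (fun a ha => by rw [hb]; exact hπ.dist_eq a _ ha) y'
    rwa [e] at this
  refine ⟨ι, σ, ⟨?_, fun x => map_notMem_range hi hP, ?_, fun p hp => (hι p hp).2, hσ⟩,
    ⟨?_, ?_, fun y => hσ' _ ⟨y, rfl⟩, ?_, ?_⟩, ⟨?_, ?_, ?_, ?_⟩⟩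
  · rintro _ ⟨a, rfl⟩
    exact ⟨f.toFun a, (hw a).symm⟩
  · intro x hx
    obtain ⟨h1, h2⟩ := hι _ (map_notMem_range hi hP hx)
    exact map_injOn_compl_range hi hP h1 hx h2
  · rintro y y' ⟨n, h⟩
    obtain ⟨m, -, h⟩ := hasPath_of_pushout_inl hi hP h
    exact ⟨m, h⟩
  · rintro p y ⟨n, h⟩
    exact mem_range_of_pushout_hasPath hi hP h
  · intro y p h
    by_cases hp : p ∈ Set.range j.toFun
    · rwa [hσ' p hp]
    · obtain ⟨b, hb, -⟩ := key p hp y h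
      rw [hσ p hp, hb, hw]
      exact ⟨_, rfl⟩
  · intro y p h
    by_cases hp : p ∈ Set.range j.toFun
    · rw [hσ' p hp, dist_self, add_zero]
    · refine le_antisymm (dist_triangle _ _ _) ?_
      obtain ⟨b, hb, h'⟩ := key p hp y h
      refine le_trans ?_ (h' y)
      rw [hσ p hp, hb, hw]
      refine add_le_add (dist_map_le j _ _) ?_
      have := dist_map_le g (i.toFun b) (ι p)
      rwa [hw, (hι p hp).2] at this
  · intro p hp q hq
    have := dist_le_pushout_inr hi hP (hι p hp).1 (hι q hq).1
    rwa [(hι p hp).2, (hι q hq).2] at this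
  · intro y p hp h
    obtain ⟨b, hb, -⟩ := key p hp y h
    exact ⟨b, hb.symm⟩
  · intro y p hp h
    obtain ⟨b, hb, h'⟩ := key p hp y h
    rw [Function.comp_apply, hb]
    exact le_add_self.trans (h' y)
  · intro a y p hp h
    by_cases hr : X.Reachable (i.toFun a) (ι p)
    · exact (hπ.dist_eq a _ hr).ge
    · rw [← dist_ne_top_iff, not_not] at hr
      rw [hr]
      exact le_top

theorem relEmap_bijective (hi : IsCofibration i) (hP : IsPushout i f g j)
    (R : Type w) [CommRing R] {r : ℕ} (hr : 1 ≤ r) (p q : ℤ) :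
    Function.Bijective (relEmap R hP.w r p q) := by
  -- If `X` is empty, a nonempty `P` has no function `ι` to `X`. In this case every vertex of `P`
  -- comes from `Y`, and both relative complexes vanish.
  rcases isEmpty_or_nonempty X.V with hX | hX
  · have hX' : ∀ n, Subsingleton ((relRC R i).C.X n) := fun n => by
      have : LinearMap.id (R := R) (M := RC R X n ⧸ LinearMap.range (RCmap R i n)) = 0 := by
        refine relHom_ext fun l hl => ?_
        cases l with
        | nil => exact (hl.1 rfl).elim
        | cons x l => exact isEmptyElim x
      exact subsingleton_of_forall_eq 0 fun x => LinearMap.congr_fun this x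
    have hP' : ∀ n, Subsingleton ((relRC R j).C.X n) := fun n => by
      have : LinearMap.id (R := R) (M := RC R P n ⧸ LinearMap.range (RCmap R j n)) = 0 := by
        refine relHom_ext fun l hl => ?_
        obtain ⟨l, rfl⟩ : l ∈ Set.range (List.map j.toFun) := by
          rw [Set.range_list_map]
          intro p _
          by_contra hp
          obtain ⟨x, -⟩ := exists_of_notMem_range hi hP hp
          exact isEmptyElim x
        refine relGen_map j (fun y y' h => ?_) n l
        obtain ⟨n, h⟩ := h
        obtain ⟨m, -, h⟩ := hasPath_of_pushout_inl hi hP h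
        exact ⟨m, h⟩
      exact subsingleton_of_forall_eq 0 fun x => LinearMap.congr_fun this x
    have h1 : Subsingleton (relE R i r p q) := (Submodule.mkQ_surjective _).subsingleton
    have h2 : Subsingleton (relE R j r p q) := (Submodule.mkQ_surjective _).subsingleton
    exact ⟨Function.injective_of_subsingleton _, fun y => ⟨0, Subsingleton.elim _ _⟩⟩
  · obtain ⟨π, hπ⟩ := hi.exists_isProjection
    obtain ⟨ι, σ, h, hσ, hk⟩ := exists_isExcisive hi hP hπ
    exact h.bijective hP.w hπ hσ hk hr p q

end Pushout

end DiGraph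

theorem mainTheorem1 (R : Type w) [CommRing R] {A X Y P : DiGraph.{u}}
    {i : A ⟶ X} {f : A ⟶ Y} {g : X ⟶ P} {j : Y ⟶ P}
    (hi : DiGraph.IsCofibration i) (hP : IsPushout i f g j) :
    (∀ r : ℕ, 1 ≤ r →
      (∀ p q : ℤ, Function.Bijective (DiGraph.relEmap R hP.w r p q)) ∧
      (∀ (p q : ℤ) (x : DiGraph.relE R i r p q),
        DiGraph.relEmap R hP.w r (p - r) (q + r - 1) (DiGraph.relEd R i r p q x) =
          DiGraph.relEd R j r p q (DiGraph.relEmap R hP.w r p q x))) ∧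
    (∀ k l : ℤ, Function.Bijective (DiGraph.relMHmap R hP.w k l)) ∧
    (∀ k l : ℤ, Function.Bijective (DiGraph.relPHmap R hP.w k l)) := by
  refine ⟨fun r hr => ⟨DiGraph.relEmap_bijective hi hP R hr, fun p q x => ?_⟩,
    fun k l => DiGraph.relEmap_bijective hi hP R le_rfl l (k - l),
    fun k l => DiGraph.relEmap_bijective hi hP R one_le_two l (k - l)⟩
  exact (DiGraph.relRCmap R hP.w).mapE_dE r p q x
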